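/- **Definitions.** All algebras, inclusions and $*$-morphisms are unital. For von Neumann algebras, *normal* means ultraweakly continuous, and $\bigvee$ denotes the generated von Neumann algebra. An *$N$-partite system* on a Hilbert space $\mathcal H$ is a family $(\mathcal M_1,\dots,\mathcal M_N)$ of pairwise commuting von Neumann algebras on $\mathcal H$; put $\mathcal M_{[N]}=\bigvee_x\mathcal M_x$. A *state* on it is a normal state on $\mathcal M_{[N]}$. The system is *factorial* if all $\mathcal M_x$ and $\mathcal M_{[N]}$ are factors. The state $\omega$ is *embezzling* if for all $d\in\mathbb N$, all unit vectors $\phi,\psi\in(\mathbb C^d)^{\otimes N}$ (identified with pure states on $M_d(\mathbb C)^{\otimes N}$) and all $\varepsilon>0$ there are unitaries $u_x\in\mathcal M_x\otimes M_d(\mathbb C)$ such that $$\|u(\omega\otimes\phi)u^*-\omega\otimes\psi\|<\varepsilon,\qquad u=\prod_x u_x\in\mathcal M_{[N]}\otimes M_d(\mathbb C)^{\otimes N},$$ where the $M_d(\mathbb C)$ belonging to $u_x$ is the $x$-th tensor factor and $\|\cdot\|$ is the norm of functionals on $\mathcal M_{[N]}\otimes M_d(\mathbb C)^{\otimes N}$.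 An *increasing net of $N$-partite systems* is a family of $N$-partite systems $(\mathcal M^{(n)}_1,\dots,\mathcal M^{(n)}_N)$ on Hilbert spaces $\mathcal H^{(n)}$, indexed by a directed set $I$, with compatible inclusions (injective normal $*$-morphisms) $\mathcal M^{(m)}_{[N]}\subset\mathcal M^{(n)}_{[N]}$ mapping $\mathcal M^{(m)}_x$ into $\mathcal M^{(n)}_x$, for $m\le n$. A *consistent $N$-partite embezzling family* on it is a family of normal states $\omega^{(n)}$ on $\mathcal M^{(n)}_{[N]}$ such that * for all $d$ and $\varepsilon>0$ there is $n$ such that for all $m\ge n$ and all unit vectors $\phi,\psi\in(\mathbb C^d)^{\otimes N}$ there are unitaries $u_x\in\mathcal M^{(m)}_x\otimes M_d(\mathbb C)$ with $\|u(\omega^{(m)}\otimes\phi)u^*-\omega^{(m)}\otimes\psi\|<\varepsilon$, $u=\prod_xu_x$; * for all $d$ and $\varepsilon>0$ there is $n$ such that for all unit vectors $\phi,\psi\in(\mathbb C^d)^{\otimes N}$ there are unitaries $u_x\in\mathcal M^{(n)}_x\otimes M_d(\mathbb C)$ with $\|u(\omega^{(m)}\otimes\phi)u^*-\omega^{(m)}\otimes\psi\|<\varepsilon$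 for all $m\ge n$, $u=\prod_xu_x$; * $\omega^{(m)}=\omega^{(n)}\restriction\mathcal M^{(m)}_{[N]}$ for $m\le n$. **Theorem.** Let $(\omega^{(n)})_n$ be a consistent $N$-partite embezzling family on an increasing net of $N$-partite systems $(\mathcal M^{(n)}_x)_{x\in[N]}$. (a) There exist an $N$-partite system $(\mathcal M_x)_{x\in[N]}$, an embezzling state $\omega$ on it and normal $*$-morphisms $j^{(n)}:\mathcal M^{(n)}_{[N]}\to\mathcal M_{[N]}$ such that 1. $j^{(n)}\restriction\mathcal M^{(m)}_{[N]}=j^{(m)}$ for $m\le n$; 2. $j^{(n)}(\mathcal M^{(n)}_x)\subset\mathcal M_x$ for all $n$ and $x$; 3. $\mathcal M_{[N]}=\bigvee_nj^{(n)}(\mathcal M^{(n)}_{[N]})$, and $\omega$ has central support $1$; 4. $\omega\circ j^{(n)}=\omega^{(n)}$ for all $n$. If $I$ has a countable cofinal subset and all $\mathcal H^{(n)}$ are separable, then $(\mathcal M_x)_x$ may be chosen on a separable Hilbert space. (b) The triple is unique up to isomorphism: if $(\mathcal M_x)_x,(j^{(n)})_n,\omega$ and $(\tilde{\mathcal M}_x)_x,(\tilde\jmath^{(n)})_n,\tilde\omega$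 are both as in (a), with properties 1–4, then there is a $*$-isomorphism $\Theta:\mathcal M_{[N]}\to\tilde{\mathcal M}_{[N]}$ with $\Theta\circ j^{(n)}=\tilde\jmath^{(n)}$ for all $n$ and $\tilde\omega\circ\Theta=\omega$. (c) If all the systems $(\mathcal M^{(n)}_x)_{x}$ are factorial, then the data in (a) (including the statement on separability) may be chosen such that, in addition, all $j^{(n)}$ are injective and $\mathcal M_x=\bigvee_nj^{(n)}(\mathcal M^{(n)}_x)$ for all $x$. If two such data as in (a) both satisfy $\mathcal M_x=\bigvee_nj^{(n)}(\mathcal M^{(n)}_x)$ for all $x$, then there is $\Theta$ as in (b) which in addition satisfies $\Theta(\mathcal M_x)=\tilde{\mathcal M}_x$ for all $x$. -/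

import Mathlib

universe u v w₁ w₂

open scoped ComplexOrder

namespace MultipartiteEmbezzlement

noncomputable section

/-! ### Von Neumann algebras, the ultraweak topology, normal maps and normal states -/

section VonNeumann

variable {H : Type*} [NormedAddCommGroup H] [InnerProductSpace ℂ H] [CompleteSpace H]

/-- The elements of a von Neumann algebra on `H`, as a type. -/
abbrev Alg (M : VonNeumannAlgebra H) : Type _ := ↥M.toStarSubalgebra

/-- A von Neumann algebra is norm closed, which makes `Alg M` a C⋆-algebra. -/
instance isClosed_alg (M : VonNeumannAlgebra H) :
    IsClosed (M.toStarSubalgebra : Set (H →L[ℂ] H)) := by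
  have h : (M.toStarSubalgebra : Set (H →L[ℂ] H)) =
      Set.centralizer (Set.centralizer (M.toStarSubalgebra : Set (H →L[ℂ] H))) :=
    M.centralizer_centralizer'.symm
  rw [h]
  exact Set.isClosed_centralizer _

/-- The order which `Alg M` inherits from the bounded operators is the usual order of a
C⋆-algebra. -/
instance starOrderedRing_alg (M : VonNeumannAlgebra H) : StarOrderedRing (Alg M) := by
  refine StarOrderedRing.of_le_iff fun x y => ⟨fun hxy => ?_, ?_⟩
  · have h0 : (0 : H →L[ℂ] H) ≤ ((y - x : Alg M) : H →L[ℂ] H) := by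
      have h1 : (x : H →L[ℂ] H) ≤ (y : H →L[ℂ] H) := hxy
      simpa using h1
    obtain ⟨s, hs⟩ : ∃ s : Alg M, y - x = star s * s := by
      have hsa : IsSelfAdjoint (y - x) := Subtype.ext (IsSelfAdjoint.of_nonneg h0)
      have hsp : SpectrumRestricts (y - x) ContinuousMap.realToNNReal := by
        rw [SpectrumRestricts.nnreal_iff]
        intro r hr
        refine spectrum_nonneg_of_nonneg h0 ?_
        have := StarSubalgebra.spectrum_eq (S := M.toStarSubalgebra) (hS := isClosed_alg M) (a := y - x)
        rw [← spectrum.algebraMap_mem_iff ℂ] at hr ⊢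
        rwa [this] at hr
      obtain ⟨s, hs, _, hs'⟩ :=
        CFC.exists_sqrt_of_isSelfAdjoint_of_quasispectrumRestricts hsa hsp
      exact ⟨s, by rw [hs.star_eq, hs']⟩
    exact ⟨s, by rw [← hs]; abel⟩
  · rintro ⟨s, rfl⟩
    have h1 : (x : H →L[ℂ] H) ≤ (x : H →L[ℂ] H) + star (s : H →L[ℂ] H) * (s : H →L[ℂ] H) :=
      le_add_of_nonneg_right (star_mul_self_nonneg _)
    exact h1

/-- The ultraweak topology of a von Neumann algebra on `H`: the initial topology for the
functionals `a ↦ ∑ₖ ⟪ξₖ, a ηₖ⟫` with square-summable sequences `ξ`, `η` of vectors. -/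
abbrev ultraweak (M : VonNeumannAlgebra H) : TopologicalSpace (Alg M) :=
  ⨅ (ξ : lp (fun _ : ℕ => H) 2) (η : lp (fun _ : ℕ => H) 2),
    TopologicalSpace.induced
      (fun a : Alg M => ∑' k : ℕ, inner ℂ (ξ k) ((a : H →L[ℂ] H) (η k))) inferInstance

/-- A (unital) *-morphism of von Neumann algebras is normal if it is ultraweakly continuous. -/
def IsNormalHom {K : Type*} [NormedAddCommGroup K] [InnerProductSpace ℂ K] [CompleteSpace K]
    {M : VonNeumannAlgebra H} {L : VonNeumannAlgebra K} (f : Alg M →⋆ₐ[ℂ] Alg L) : Prop :=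
  @Continuous _ _ (ultraweak M) (ultraweak L) f

/-- Normal states: ultraweakly continuous, positive, normalized linear functionals. -/
structure NormalState (M : VonNeumannAlgebra H) where
  /-- the underlying bounded functional -/
  toCLM : Alg M →L[ℂ] ℂ
  nonneg' : ∀ a : Alg M, 0 ≤ toCLM (star a * a)
  map_one' : toCLM 1 = 1
  normal' : @Continuous _ _ (ultraweak M) inferInstance toCLM

/-- The central support of a normal state is the least central projection `p` with `ω p = 1`;
it equals `1` exactly if no central projection other than `1` has this property. -/
def NormalState.CentralSupportEqOne {M : VonNeumannAlgebra H} (ω : NormalState M) : Prop :=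
  ∀ p : Alg M, IsStarProjection p → (∀ a : Alg M, p * a = a * p) → ω.toCLM p = 1 → p = 1

/-- A factor is a von Neumann algebra with trivial center. -/
def IsFactor (M : VonNeumannAlgebra H) : Prop :=
  ∀ z : H →L[ℂ] H, z ∈ M → z ∈ M.commutant → ∃ c : ℂ, z = c • (1 : H →L[ℂ] H)

/-- The von Neumann algebra `(s ∪ s*)''` generated by a set `s` of bounded operators. -/
def vnGen (s : Set (H →L[ℂ] H)) : VonNeumannAlgebra H where
  toStarSubalgebra :=
    StarSubalgebra.centralizer ℂ (StarSubalgebra.centralizer ℂ s : Set (H →L[ℂ] H))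
  centralizer_centralizer' := by
    have h : (StarSubalgebra.centralizer ℂ
        (StarSubalgebra.centralizer ℂ s : Set (H →L[ℂ] H))).carrier =
        Set.centralizer ((StarSubalgebra.centralizer ℂ s : Set (H →L[ℂ] H)) ∪
          star (StarSubalgebra.centralizer ℂ s : Set (H →L[ℂ] H))) :=
      StarSubalgebra.coe_centralizer ℂ _
    rw [h, Set.centralizer_centralizer_centralizer]

theorem subset_vnGen (s : Set (H →L[ℂ] H)) : s ⊆ (vnGen s).toStarSubalgebra := by
  intro a ha
  change a ∈ StarSubalgebra.centralizer ℂ (StarSubalgebra.centralizer ℂ s : Set (H →L[ℂ] H))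
  rw [StarSubalgebra.mem_centralizer_iff]
  intro g hg
  have h1 := (StarSubalgebra.mem_centralizer_iff ℂ).mp hg a ha
  have h2 := (StarSubalgebra.mem_centralizer_iff ℂ).mp (star_mem hg) a ha
  exact ⟨h1.1.symm, h2.1.symm⟩

end VonNeumann

/-! ### Multipartite systems -/

/-- An `N`-partite system on a Hilbert space: `N` pairwise commuting von Neumann algebras. -/
structure PartiteSystem (N : ℕ) (H : Type*) [NormedAddCommGroup H] [InnerProductSpace ℂ H]
    [CompleteSpace H] where
  /-- the algebra of each party -/
  loc : Fin N → VonNeumannAlgebra H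
  comm : ∀ x y, x ≠ y → ∀ a ∈ loc x, ∀ b ∈ loc y, a * b = b * a

namespace PartiteSystem

variable {N : ℕ} {H : Type*} [NormedAddCommGroup H] [InnerProductSpace ℂ H] [CompleteSpace H]

/-- The `N`-partite algebra, generated by the algebras of all the parties. -/
def total (S : PartiteSystem N H) : VonNeumannAlgebra H :=
  vnGen (⋃ x, (S.loc x : Set (H →L[ℂ] H)))

/-- The inclusion of the algebra of a party into the `N`-partite algebra. -/
def incl (S : PartiteSystem N H) (x : Fin N) : Alg (S.loc x) →⋆ₐ[ℂ] Alg S.total :=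
  StarSubalgebra.inclusion fun _ ha =>
    subset_vnGen _ (Set.mem_iUnion.mpr ⟨x, ha⟩)

/-- The system is factorial if all algebras of the parties and the `N`-partite algebra are
factors. -/
def IsFactorial (S : PartiteSystem N H) : Prop :=
  (∀ x, IsFactor (S.loc x)) ∧ IsFactor S.total

end PartiteSystem

/-! ### Amplification by matrices

For a von Neumann algebra `M`, the algebra `M ⊗ M_ι(ℂ)` is the C⋆-algebra of `ι × ι` matrices
over `M`.  The algebra of the `N`-partite system on `(ℂ^d)^{⊗N}` is the algebra of matrices
indexed by `Fin N → Fin d`, and its pure states are the unit vectors of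
`EuclideanSpace ℂ (Fin N → Fin d)`. -/

section Amplification

variable {A : Type*} [CStarAlgebra A] [PartialOrder A] [StarOrderedRing A]
variable {ι : Type*} [Fintype ι] [DecidableEq ι]

/-- The `(i, j)` entry of a matrix over a C⋆-algebra, as a bounded linear map. -/
def entry (i j : ι) : CStarMatrix ι ι A →L[ℂ] A :=
  LinearMap.mkContinuous
    { toFun := fun T => T i j
      map_add' := fun _ _ => rfl
      map_smul' := fun _ _ => rfl } 1
    (fun T => by
      rw [one_mul]
      exact CStarMatrix.norm_entry_le_norm (M := T))

/-- The functional `ω ⊗ ⟨φ| · |φ⟩` on `A ⊗ M_ι(ℂ)`. -/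
def tensorPure (ω : A →L[ℂ] ℂ) (φ : EuclideanSpace ℂ ι) : CStarMatrix ι ι A →L[ℂ] ℂ :=
  ∑ i, ∑ j, (star (φ i) * φ j) • ω.comp (entry i j)

/-- The functional `v χ v* = χ (v* · v)`. -/
def conjBy (v : CStarMatrix ι ι A) (χ : CStarMatrix ι ι A →L[ℂ] ℂ) :
    CStarMatrix ι ι A →L[ℂ] ℂ :=
  χ.comp (ContinuousLinearMap.mulLeftRight ℂ (CStarMatrix ι ι A) (star v) v)

/-- The distance `‖v (ω ⊗ φ) v* - ω ⊗ ψ‖`, for `ω` a functional on `A` and pure states `φ`, `ψ`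
on `M_ι(ℂ)`, in the norm of functionals on `A ⊗ M_ι(ℂ)`. -/
def embezzlingError (ω : A →L[ℂ] ℂ) (v : CStarMatrix ι ι A) (φ ψ : EuclideanSpace ℂ ι) : ℝ :=
  ‖conjBy v (tensorPure ω φ) - tensorPure ω ψ‖

end Amplification

section Local

variable {N : ℕ} {H : Type*} [NormedAddCommGroup H] [InnerProductSpace ℂ H] [CompleteSpace H]

/-- An element of `M_x ⊗ M_d(ℂ)` as an element of `M_{[N]} ⊗ M_d(ℂ)^{⊗N}`, acting on the `x`-th
tensor factor. -/
def PartiteSystem.atParty (S : PartiteSystem N H) {d : ℕ} (x : Fin N)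
    (b : CStarMatrix (Fin d) (Fin d) (Alg (S.loc x))) :
    CStarMatrix (Fin N → Fin d) (Fin N → Fin d) (Alg S.total) :=
  CStarMatrix.ofMatrix fun i j =>
    if ∀ y, y ≠ x → i y = j y then S.incl x (b (i x) (j x)) else 0

/-- Local unitaries: one unitary in `M_x ⊗ M_d(ℂ)` for each party `x`. -/
abbrev PartiteSystem.LocalUnitaries (S : PartiteSystem N H) (d : ℕ) : Type _ :=
  (x : Fin N) → unitary (CStarMatrix (Fin d) (Fin d) (Alg (S.loc x)))

/-- The product `∏ₓ uₓ` in `M_{[N]} ⊗ M_d(ℂ)^{⊗N}` (the factors commute). -/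
def PartiteSystem.prodUnitary (S : PartiteSystem N H) {d : ℕ} (U : S.LocalUnitaries d) :
    CStarMatrix (Fin N → Fin d) (Fin N → Fin d) (Alg S.total) :=
  (List.ofFn fun x => S.atParty x (U x : CStarMatrix (Fin d) (Fin d) (Alg (S.loc x)))).prod

/-- `N`-partite embezzling states. -/
def PartiteSystem.IsEmbezzling (S : PartiteSystem N H) (ω : NormalState S.total) : Prop :=
  ∀ (d : ℕ) (φ ψ : EuclideanSpace ℂ (Fin N → Fin d)), ‖φ‖ = 1 → ‖ψ‖ = 1 →
    ∀ ε : ℝ, 0 < ε → ∃ U : S.LocalUnitaries d,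
      embezzlingError ω.toCLM (S.prodUnitary U) φ ψ < ε

end Local

/-! ### Increasing nets and embezzling families -/

/-- An increasing net of `N`-partite systems.  The inclusions of the `N`-partite algebras are
given as injective, normal, unital *-morphisms which map the algebra of each party into the
algebra of the same party; the systems need not act on a common Hilbert space. -/
structure IncreasingNet (N : ℕ) (I : Type u) [Preorder I] (H : I → Type v)
    [∀ n, NormedAddCommGroup (H n)] [∀ n, InnerProductSpace ℂ (H n)]
    [∀ n, CompleteSpace (H n)] where
  /-- the systems of the net -/
  sys : (n : I) → PartiteSystem N (H n)
  /-- the inclusions -/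
  inc : {m n : I} → m ≤ n → (Alg (sys m).total →⋆ₐ[ℂ] Alg (sys n).total)
  inc_injective : ∀ {m n : I} (h : m ≤ n), Function.Injective (inc h)
  inc_normal : ∀ {m n : I} (h : m ≤ n), IsNormalHom (inc h)
  inc_loc : ∀ {m n : I} (h : m ≤ n) (x : Fin N) (a : Alg (sys m).total),
    (a : H m →L[ℂ] H m) ∈ (sys m).loc x → (inc h a : H n →L[ℂ] H n) ∈ (sys n).loc x
  inc_refl : ∀ (n : I) (a : Alg (sys n).total), inc (le_refl n) a = a
  inc_trans : ∀ {l m n : I} (h : l ≤ m) (h' : m ≤ n) (a : Alg (sys l).total),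
    inc h' (inc h a) = inc (h.trans h') a

section Families

variable {N : ℕ} {I : Type u} [Preorder I] {H : I → Type v}
  [∀ n, NormedAddCommGroup (H n)] [∀ n, InnerProductSpace ℂ (H n)] [∀ n, CompleteSpace (H n)]

/-- `N`-partite embezzling families. -/
def IsEmbezzlingFamily (D : IncreasingNet N I H) (ω : (n : I) → NormalState (D.sys n).total) :
    Prop :=
  ∀ (d : ℕ) (ε : ℝ), 0 < ε → ∃ n : I, ∀ m, n ≤ m →
    ∀ φ ψ : EuclideanSpace ℂ (Fin N → Fin d), ‖φ‖ = 1 → ‖ψ‖ = 1 →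
      ∃ U : (D.sys m).LocalUnitaries d,
        embezzlingError (ω m).toCLM ((D.sys m).prodUnitary U) φ ψ < ε

/-- Quasi-consistency: the unitaries may be taken from a fixed stage `n = n(d, ε)` and work for
all later stages. -/
def IsQuasiConsistent (D : IncreasingNet N I H) (ω : (n : I) → NormalState (D.sys n).total) :
    Prop :=
  ∀ (d : ℕ) (ε : ℝ), 0 < ε → ∃ n : I,
    ∀ φ ψ : EuclideanSpace ℂ (Fin N → Fin d), ‖φ‖ = 1 → ‖ψ‖ = 1 →
      ∃ U : (D.sys n).LocalUnitaries d, ∀ (m : I) (h : n ≤ m),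
        embezzlingError (ω m).toCLM (((D.sys n).prodUnitary U).map (D.inc h)) φ ψ < ε

/-- Consistent `N`-partite embezzling families. -/
structure IsConsistentEmbezzlingFamily (D : IncreasingNet N I H)
    (ω : (n : I) → NormalState (D.sys n).total) : Prop where
  embezzling : IsEmbezzlingFamily D ω
  quasiConsistent : IsQuasiConsistent D ω
  restrict : ∀ {m n : I} (h : m ≤ n) (a : Alg (D.sys m).total),
    (ω n).toCLM (D.inc h a) = (ω m).toCLM a

/-- An `N`-partite system `S` on `K` with an embezzling state `σ` and compatible normal
*-morphisms `j n` is a limit of the family `ω` on the increasing net `D`. -/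
structure IsEmbezzlingLimit (D : IncreasingNet N I H) (ω : (n : I) → NormalState (D.sys n).total)
    {K : Type*} [NormedAddCommGroup K] [InnerProductSpace ℂ K] [CompleteSpace K]
    (S : PartiteSystem N K) (j : (n : I) → Alg (D.sys n).total →⋆ₐ[ℂ] Alg S.total)
    (σ : NormalState S.total) : Prop where
  embezzling : S.IsEmbezzling σ
  normal : ∀ n, IsNormalHom (j n)
  compat : ∀ {m n : I} (h : m ≤ n) (a : Alg (D.sys m).total), j n (D.inc h a) = j m a
  map_loc : ∀ (n : I) (x : Fin N) (a : Alg (D.sys n).total),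
    (a : H n →L[ℂ] H n) ∈ (D.sys n).loc x → (j n a : K →L[ℂ] K) ∈ S.loc x
  total_eq : S.total =
    vnGen (⋃ n, Set.range fun a : Alg (D.sys n).total => (j n a : K →L[ℂ] K))
  centralSupport : σ.CentralSupportEqOne
  state_comp : ∀ (n : I) (a : Alg (D.sys n).total), σ.toCLM (j n a) = (ω n).toCLM a

/-- The system `S` is generated by the net via the *-morphisms `j n`: the algebra of each party
`x` is the von Neumann algebra generated by the images of the algebras of `x` in the net. -/
def IsGeneratedBy (D : IncreasingNet N I H)
    {K : Type*} [NormedAddCommGroup K] [InnerProductSpace ℂ K] [CompleteSpace K]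
    (S : PartiteSystem N K) (j : (n : I) → Alg (D.sys n).total →⋆ₐ[ℂ] Alg S.total) : Prop :=
  ∀ x, S.loc x = vnGen (⋃ n, (fun a : Alg (D.sys n).total => (j n a : K →L[ℂ] K)) ''
    {a | (a : H n →L[ℂ] H n) ∈ (D.sys n).loc x})

end Families

end

end MultipartiteEmbezzlement

open MultipartiteEmbezzlement

/-!
The limit is the GNS representation of the algebraic direct limit of the algebras
`M⁽ⁿ⁾_{[N]}`.  The states `ω⁽ⁿ⁾` define a state on the direct limit `LimAlg D`, whose GNS
representation `π` acts on a Hilbert space with a cyclic vector `Ω`.  The party `x` gets the von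
Neumann algebra generated by the elements of `π (LimAlg D)` that come from the algebras of `x`
(`limSystem`), and the state is the vector state of `Ω`.

* *Normality* (`limHom_isNormal`).  By the Radon–Nikodym theorem for positive functionals
  (`exists_vector_of_le`), every normal positive functional on `M` is of the form
  `⟪ζ, (· ⊗ 1) ζ⟫`, and a functional dominated by one of this form has this form.  The vectors
  `π(b) Ω` therefore give normal functionals, and so do all vectors, since these are limits of
  rapidly convergent series of such ones (`isNormalVector_of_dense`).
* *Generation* (`IsLimGNS.mem_total`).  The amplification of `M⁽ⁿ⁾_{[N]}` has an intertwiner `W` to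
  `π` with `Ω` in its range (`IsLimGNS.exists_stage_intertwiner`).  If `T` commutes with the
  algebras of all parties, then `W* T W` commutes with those of stage `n`, hence with
  `M⁽ⁿ⁾_{[N]} ⊗ 1`; so `T` commutes with `π (LimAlg D)`.  The same intertwiners show that the space
  is separable if the net has a cofinal sequence and acts on separable spaces.
* *Embezzlement* (`IsLimGNS.isEmbezzling`).  Both terms of
  `u (σ ⊗ φ) u* - σ ⊗ ψ` are vector functionals on matrices over `π (LimAlg D)''`.  The restriction
  of the difference to a late stage has norm less than `ε / 2` if `u` comes from quasi-consistency.
  The bound extends to the whole algebra as in Kaplansky's density theorem: a self-adjoint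
  contraction is of the form `2y / (1 + y²)`, this function is strongly continuous, and the
  self-adjoint matrices over the stages are strongly dense (`norm_le_of_approx`).
* *Injectivity* (`limHom_injective`).  If `a` is in the kernel and `ζ` implements `ω⁽ⁿ⁾` in the
  amplification, then `a M ζ = 0`; the projection onto `{w | a M w = 0}` is central and nonzero, so it
  is `1` if `M` is a factor.
* *Uniqueness* (`IsEmbezzlingLimit.exists_starAlgEquiv`).  Let `ρ` be the representation of
  `LimAlg D` on the space of some limit with state `σ`.  A vector implementing `σ` in the
  amplification gives an isometric intertwiner `V` from `π` to `ρ ⊗ 1`.  Then `b ↦ V* (b ⊗ 1) V`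
  maps `ρ (LimAlg D)''` to `π (LimAlg D)''`; it is an isomorphism because the central support of
  `σ` is `1` (`exists_quasiEquiv`), and it is compatible with the subalgebras of the parties.
-/

namespace MultipartiteEmbezzlement

noncomputable section

open scoped InnerProductSpace

/-! ### Amplification to square-summable sequences -/

section Amplify

variable {H : Type*} [NormedAddCommGroup H] [InnerProductSpace ℂ H]

/-- The Hilbert space `ℓ²(ℕ, H) = H ⊗ ℓ²`. -/
abbrev L2 (H : Type*) [NormedAddCommGroup H] [InnerProductSpace ℂ H] : Type _ :=
  lp (fun _ : ℕ => H) 2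

/-- The operator `a ⊗ 1` on `H ⊗ ℓ²`, acting on each entry of a sequence. -/
def amp (a : H →L[ℂ] H) : L2 H →L[ℂ] L2 H :=
  lp.mapCLM 2 (fun _ : ℕ => a) (norm_nonneg a) fun _ => le_rfl

@[simp]
theorem amp_apply (a : H →L[ℂ] H) (ξ : L2 H) (k : ℕ) : amp a ξ k = a (ξ k) := rfl

theorem inner_amp (a : H →L[ℂ] H) (ξ η : L2 H) :
    ⟪ξ, amp a η⟫_ℂ = ∑' k, ⟪ξ k, a (η k)⟫_ℂ := lp.inner_eq_tsum _ _

/-- The inclusion of `H` as the `k`-th summand of `H ⊗ ℓ²`. -/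
abbrev slot (k : ℕ) : H →L[ℂ] L2 H :=
  lp.singleContinuousLinearMap ℂ (fun _ : ℕ => H) 2 k

/-- The projection of `H ⊗ ℓ²` onto its `k`-th summand. -/
abbrev coord (k : ℕ) : L2 H →L[ℂ] H := lp.evalCLM ℂ (fun _ : ℕ => H) 2 k

@[simp]
theorem coord_apply (k : ℕ) (ξ : L2 H) : coord k ξ = ξ k := rfl

theorem amp_slot (a : H →L[ℂ] H) (k : ℕ) (x : H) : amp a (slot k x) = slot k (a x) := by
  ext l
  by_cases h : l = k
  · subst h; simp
  · simp [Pi.single_eq_of_ne h]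

theorem memℓp_flatten (Ξ : L2 (L2 H)) :
    Memℓp (fun k : ℕ => (Ξ (Nat.unpair k).1 : L2 H) (Nat.unpair k).2) 2 := by
  have h2 : (0 : ℝ) < (2 : ENNReal).toReal := by norm_num
  refine (memℓp_gen_iff h2).2 ?_
  have : Summable fun p : ℕ × ℕ => ‖(Ξ p.1 : L2 H) p.2‖ ^ (2 : ENNReal).toReal := by
    refine (summable_prod_of_nonneg fun p => by positivity).2 ⟨fun k => ?_, ?_⟩
    · exact (memℓp_gen_iff h2).1 (lp.memℓp (Ξ k))
    · have h := (memℓp_gen_iff h2).1 (lp.memℓp Ξ)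
      refine h.congr fun k => ?_
      rw [lp.norm_rpow_eq_tsum h2]
  have h' := (Nat.pairEquiv.symm.summable_iff
    (f := fun p : ℕ × ℕ => ‖(Ξ p.1 : L2 H) p.2‖ ^ (2 : ENNReal).toReal)).2 this
  exact h'

/-- A square-summable sequence of elements of `H ⊗ ℓ²`, as one element of `H ⊗ ℓ²`, along the
bijection `Nat.unpair`. -/
def flatten (Ξ : L2 (L2 H)) : L2 H :=
  ⟨fun k => (Ξ (Nat.unpair k).1 : L2 H) (Nat.unpair k).2, memℓp_flatten Ξ⟩

theorem flatten_apply (Ξ : L2 (L2 H)) (k : ℕ) :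
    flatten Ξ k = Ξ (Nat.unpair k).1 (Nat.unpair k).2 := rfl

/-- The sequence encoded by `flatten` implements the sum of the functionals of its entries. -/
theorem inner_flatten (a : H →L[ℂ] H) (Ξ Θ : L2 (L2 H)) :
    ⟪flatten Ξ, amp a (flatten Θ)⟫_ℂ = ⟪Ξ, amp (amp a) Θ⟫_ℂ := by
  have h := lp.hasSum_inner (𝕜 := ℂ) (flatten Ξ) (amp a (flatten Θ))
  have h' := (Nat.pairEquiv.hasSum_iff (a := ⟪flatten Ξ, amp a (flatten Θ)⟫_ℂ)
    (f := fun k => (⟪(flatten Ξ k : H), a (flatten Θ k)⟫_ℂ : ℂ))).2 h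
  have h'' := h'.prod_fiberwise (g := fun k => (⟪(Ξ k : L2 H), amp a (Θ k)⟫_ℂ : ℂ)) fun k => by
    have := lp.hasSum_inner (𝕜 := ℂ) (Ξ k : L2 H) (amp a (Θ k))
    simpa [Function.comp_def, flatten_apply] using this
  exact h''.unique (lp.hasSum_inner (𝕜 := ℂ) Ξ (amp (amp a) Θ))

variable [CompleteSpace H]

/-- The amplification `a ↦ a ⊗ 1` as a *-morphism. -/
def ampHom (H : Type*) [NormedAddCommGroup H] [InnerProductSpace ℂ H] [CompleteSpace H] :
    (H →L[ℂ] H) →⋆ₐ[ℂ] (L2 H →L[ℂ] L2 H) where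
  toFun := amp
  map_one' := by ext ξ k; simp
  map_mul' a b := by ext ξ k; simp
  map_zero' := by ext ξ k; simp
  map_add' a b := by ext ξ k; simp
  commutes' c := by ext ξ k; simp [Algebra.algebraMap_eq_smul_one]
  map_star' a := by
    rw [ContinuousLinearMap.star_eq_adjoint, ContinuousLinearMap.star_eq_adjoint,
      ContinuousLinearMap.eq_adjoint_iff]
    intro ξ η
    simp [lp.inner_eq_tsum, ContinuousLinearMap.adjoint_inner_left]

theorem ampHom_apply (a : H →L[ℂ] H) : ampHom H a = amp a := rfl

@[simp]
theorem amp_add (a b : H →L[ℂ] H) : amp (a + b) = amp a + amp b := map_add (ampHom H) a b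

@[simp]
theorem amp_zero : amp (0 : H →L[ℂ] H) = 0 := map_zero (ampHom H)

@[simp]
theorem amp_sub (a b : H →L[ℂ] H) : amp (a - b) = amp a - amp b := map_sub (ampHom H) a b

@[simp]
theorem amp_smul (c : ℂ) (a : H →L[ℂ] H) : amp (c • a) = c • amp a := map_smul (ampHom H) c a

@[simp]
theorem amp_mul (a b : H →L[ℂ] H) : amp (a * b) = amp a * amp b := map_mul (ampHom H) a b

@[simp]
theorem amp_one : amp (1 : H →L[ℂ] H) = 1 := map_one (ampHom H)

@[simp]
theorem amp_star (a : H →L[ℂ] H) : amp (star a) = star (amp a) := map_star (ampHom H) a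

theorem inner_star_apply (a : H →L[ℂ] H) (x y : H) : ⟪star a x, y⟫_ℂ = ⟪x, a y⟫_ℂ := by
  rw [ContinuousLinearMap.star_eq_adjoint, ContinuousLinearMap.adjoint_inner_left]

/-- The double commutant of `X ⊗ 1` contains `X'' ⊗ 1`, since the matrix coefficients of an operator
in the commutant of `X ⊗ 1` belong to the commutant of `X`. -/
theorem amp_commute_of_mem_vnGen {X : Set (H →L[ℂ] H)} {b : H →L[ℂ] H}
    (hb : b ∈ vnGen X) {T : L2 H →L[ℂ] L2 H}
    (hT : ∀ x ∈ X, T * amp x = amp x * T) (hT' : ∀ x ∈ X, T * amp (star x) = amp (star x) * T) :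
    T * amp b = amp b * T := by
  have key : ∀ k l : ℕ, (coord l ∘L T ∘L slot k) * b = b * (coord l ∘L T ∘L slot k) := by
    intro k l
    have hmem : (coord l ∘L T ∘L slot k) ∈ StarSubalgebra.centralizer ℂ X := by
      have aux : ∀ x : H →L[ℂ] H, T * amp x = amp x * T →
          x * (coord l ∘L T ∘L slot k) = (coord l ∘L T ∘L slot k) * x := by
        intro x hx
        ext ξ
        have := congrArg (fun S : L2 H →L[ℂ] L2 H => S (slot k ξ) l) hx
        simp only [mul_apply_eq_comp, amp_slot, amp_apply] at this
        simpa using this.symm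
      rw [StarSubalgebra.mem_centralizer_iff]
      exact fun x hx => ⟨aux x (hT x hx), aux _ (hT' x hx)⟩
    have hb' : b ∈ StarSubalgebra.centralizer ℂ
      (StarSubalgebra.centralizer ℂ X : Set (H →L[ℂ] H)) := hb
    exact ((StarSubalgebra.mem_centralizer_iff ℂ).mp hb' _ hmem).1
  refine lp.ext_continuousLinearMap (by simp) fun k => ?_
  ext ξ l
  have := congrArg (fun S : H →L[ℂ] H => S ξ) (key k l)
  simp only [mul_apply_eq_comp, ContinuousLinearMap.comp_apply] at this
  simp only [mul_apply_eq_comp, ContinuousLinearMap.comp_apply, amp_apply]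
  rw [show (lp.singleContinuousLinearMap ℂ (fun _ : ℕ => H) 2 k) ξ = slot k ξ from rfl, amp_slot]
  exact this

end Amplify

/-! ### Ultraweakly continuous functionals -/

section Ultraweak

variable {H : Type*} [NormedAddCommGroup H] [InnerProductSpace ℂ H] [CompleteSpace H]

theorem continuous_ultraweak_inner_amp (M : VonNeumannAlgebra H) (ξ η : L2 H) :
    @Continuous _ _ (ultraweak M) inferInstance
      (fun a : Alg M => ⟪ξ, amp (a : H →L[ℂ] H) η⟫_ℂ) := by
  simp_rw [inner_amp]
  exact continuous_iInf_dom (i := ξ) (continuous_iInf_dom (i := η) continuous_induced_dom)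

theorem continuous_ultraweak_rng {X : Type*} [TopologicalSpace X] {M : VonNeumannAlgebra H}
    {g : X → Alg M}
    (h : ∀ ξ η : L2 H, Continuous fun x => ⟪ξ, amp (g x : H →L[ℂ] H) η⟫_ℂ) :
    @Continuous _ _ _ (ultraweak M) g := by
  refine continuous_iInf_rng.2 fun ξ => continuous_iInf_rng.2 fun η =>
    continuous_induced_rng.2 ?_
  have := h ξ η
  simp_rw [inner_amp] at this
  exact this

/-- An ultraweakly continuous functional is of the form `a ↦ ⟪ξ, (a ⊗ 1) η⟫`: such functionals are
closed under linear combinations. -/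
theorem exists_inner_amp_of_continuous {M : VonNeumannAlgebra H} (f : Alg M →ₗ[ℂ] ℂ)
    (hf : @Continuous _ _ (ultraweak M) inferInstance f) :
    ∃ ξ η : L2 H, ∀ a : Alg M, f a = ⟪ξ, amp (a : H →L[ℂ] H) η⟫_ℂ := by
  let F : L2 H × L2 H → (Alg M →ₗ[ℂ] ℂ) := fun p =>
    { toFun := fun a => ⟪p.1, amp (a : H →L[ℂ] H) p.2⟫_ℂ
      map_add' := by intro a b; simp
      map_smul' := by intro c a; simp }
  have hspan : f ∈ Submodule.span ℂ (Set.range F) := by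
    rw [LinearMap.mem_span_iff_continuous]
    convert hf using 1
    rw [iInf_prod]
    refine iInf_congr fun ξ => iInf_congr fun η => ?_
    exact congrArg (fun g => TopologicalSpace.induced g _) (funext fun a => inner_amp _ _ _)
  clear hf
  induction hspan using Submodule.span_induction with
  | mem g hg =>
    obtain ⟨p, rfl⟩ := hg
    exact ⟨p.1, p.2, fun _ => rfl⟩
  | zero => exact ⟨0, 0, fun a => by simp⟩
  | add g h _ _ ihg ihh =>
    obtain ⟨ξ₁, η₁, h₁⟩ := ihg
    obtain ⟨ξ₂, η₂, h₂⟩ := ihh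
    refine ⟨flatten (slot 0 ξ₁ + slot 1 ξ₂), flatten (slot 0 η₁ + slot 1 η₂), fun a => ?_⟩
    rw [inner_flatten, map_add, amp_slot, amp_slot, LinearMap.add_apply, h₁, h₂]
    simp [lp.inner_single_left]
  | smul c g _ ih =>
    obtain ⟨ξ, η, h⟩ := ih
    exact ⟨ξ, c • η, fun a => by simp [h]⟩

end Ultraweak

/-! ### The Gelfand–Naimark–Segal construction for *-algebras -/

section GNS

variable {𝒜 : Type*} [Ring 𝒜] [StarRing 𝒜] [Algebra ℂ 𝒜] [StarModule ℂ 𝒜]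

/-- A positive functional on a unital *-algebra is hermitian. -/
theorem map_star_of_nonneg {f : 𝒜 →ₗ[ℂ] ℂ} (hf : ∀ a, 0 ≤ f (star a * a)) (a : 𝒜) :
    f (star a) = star (f a) := by
  have key : ∀ b : 𝒜, (f b + f (star b)).im = 0 := by
    intro b
    have h1 := (Complex.nonneg_iff.1 (hf (1 + b))).2
    have h2 := (Complex.nonneg_iff.1 (hf 1)).2
    have h3 := (Complex.nonneg_iff.1 (hf b)).2
    have : star (1 + b) * (1 + b) = star 1 * 1 + b + star b + star b * b := by
      simp only [star_add, star_one]; noncomm_ring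
    rw [this] at h1
    simp only [map_add, Complex.add_im] at h1 ⊢
    linarith
  have h1 := key a
  have h2 := key (Complex.I • a)
  simp only [star_smul, map_smul, Complex.star_def, Complex.conj_I, smul_eq_mul, Complex.add_im,
    Complex.mul_im, Complex.I_re, Complex.I_im, Complex.neg_re, Complex.neg_im] at h1 h2
  apply Complex.ext
  · simp only [Complex.star_def, Complex.conj_re]; linarith
  · simp only [Complex.star_def, Complex.conj_im]; linarith

/-- The *-algebra `𝒜`, to be equipped with the semi-inner product `⟪a, b⟫ = f (a⋆ b)`. -/
def PreGNS (f : 𝒜 →ₗ[ℂ] ℂ) (_ : ∀ a, 0 ≤ f (star a * a)) : Type _ := 𝒜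

variable (f : 𝒜 →ₗ[ℂ] ℂ) (hf : ∀ a, 0 ≤ f (star a * a))

instance : AddCommGroup (PreGNS f hf) := inferInstanceAs (AddCommGroup 𝒜)
instance : Module ℂ (PreGNS f hf) := inferInstanceAs (Module ℂ 𝒜)

/-- The identity map from the *-algebra to its version with a semi-inner product. -/
def toPreGNS : 𝒜 ≃ₗ[ℂ] PreGNS f hf := LinearEquiv.refl ℂ _

/-- The semi-inner product `⟪a, b⟫ = f (a⋆ b)`. -/
abbrev preGNSCore : PreInnerProductSpace.Core ℂ (PreGNS f hf) where
  inner a b := f (star ((toPreGNS f hf).symm a) * (toPreGNS f hf).symm b)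
  conj_inner_symm a b := by
    rw [← Complex.star_def, ← map_star_of_nonneg hf]
    simp
  re_inner_nonneg a := (Complex.nonneg_iff.1 (hf _)).1
  add_left _ _ _ := by rw [map_add, star_add, add_mul, map_add]
  smul_left _ _ _ := by simp

instance : SeminormedAddCommGroup (PreGNS f hf) :=
  InnerProductSpace.Core.toSeminormedAddCommGroup (c := preGNSCore f hf)
instance : InnerProductSpace ℂ (PreGNS f hf) := InnerProductSpace.ofCore (preGNSCore f hf)

theorem preGNS_inner (a b : 𝒜) :
    ⟪toPreGNS f hf a, toPreGNS f hf b⟫_ℂ = f (star a * b) := rfl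

theorem preGNS_norm_sq (a : 𝒜) : ‖toPreGNS f hf a‖ ^ 2 = (f (star a * a)).re := by
  rw [← preGNS_inner f hf, ← inner_self_eq_norm_sq (𝕜 := ℂ)]
  rfl

variable {f}

/-- Left multiplication on the semi-inner product space, where it is bounded. -/
def preGNSMul (hb : ∀ a, ∃ C : ℝ, ∀ b, (f (star (a * b) * (a * b))).re ≤ C * (f (star b * b)).re)
    (a : 𝒜) : PreGNS f hf →L[ℂ] PreGNS f hf :=
  LinearMap.mkContinuousOfExistsBound
    ((toPreGNS f hf).toLinearMap ∘ₗ LinearMap.mulLeft ℂ a ∘ₗ (toPreGNS f hf).symm.toLinearMap) <| by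
    obtain ⟨C, hC⟩ := hb a
    refine ⟨√|C|, fun x => ?_⟩
    obtain ⟨b, rfl⟩ := (toPreGNS f hf).surjective x
    refine le_of_sq_le_sq ?_ (by positivity)
    have h1 := preGNS_norm_sq f hf (a * b)
    have h2 := preGNS_norm_sq f hf b
    have h3 : ‖toPreGNS f hf (a * b)‖ ^ 2 ≤ |C| * ‖toPreGNS f hf b‖ ^ 2 := by
      rw [h1, h2]
      exact (hC b).trans (mul_le_mul_of_nonneg_right (le_abs_self C) (h2 ▸ sq_nonneg _))
    simpa [mul_pow] using h3

theorem preGNSMul_apply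
    (hb : ∀ a, ∃ C : ℝ, ∀ b, (f (star (a * b) * (a * b))).re ≤ C * (f (star b * b)).re)
    (a b : 𝒜) : preGNSMul hf hb a (toPreGNS f hf b) = toPreGNS f hf (a * b) := rfl

open UniformSpace Completion in
/-- The GNS construction: a positive functional on a unital *-algebra for which left
multiplications are bounded is a vector functional in a cyclic *-representation. -/
theorem exists_gns {𝒜 : Type u} [Ring 𝒜] [StarRing 𝒜] [Algebra ℂ 𝒜] [StarModule ℂ 𝒜]
    {f : 𝒜 →ₗ[ℂ] ℂ} (hf : ∀ a, 0 ≤ f (star a * a))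
    (hb : ∀ a, ∃ C : ℝ, ∀ b, (f (star (a * b) * (a * b))).re ≤ C * (f (star b * b)).re) :
    ∃ (G : Type u) (_ : NormedAddCommGroup G) (_ : InnerProductSpace ℂ G) (_ : CompleteSpace G)
      (π : 𝒜 →⋆ₐ[ℂ] (G →L[ℂ] G)) (Ω : G),
      DenseRange (fun a => π a Ω) ∧ ∀ a, ⟪Ω, π a Ω⟫_ℂ = f a := by
  have hext : ∀ S T : Completion (PreGNS f hf) →L[ℂ] Completion (PreGNS f hf),
      (∀ b : 𝒜, S (toPreGNS f hf b : PreGNS f hf) = T (toPreGNS f hf b : PreGNS f hf)) →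
      S = T := by
    intro S T h
    ext x
    induction x using Completion.induction_on with
    | hp => exact isClosed_eq S.continuous T.continuous
    | ih x =>
      obtain ⟨b, rfl⟩ := (toPreGNS f hf).surjective x
      exact h b
  have hmul : ∀ a b : 𝒜, (preGNSMul hf hb a).completion (toPreGNS f hf b : PreGNS f hf) =
      ((toPreGNS f hf (a * b) : PreGNS f hf) : Completion (PreGNS f hf)) := fun a b => by
    rw [ContinuousLinearMap.completion_apply_coe, preGNSMul_apply]
  let π : 𝒜 →⋆ₐ[ℂ] (Completion (PreGNS f hf) →L[ℂ] Completion (PreGNS f hf)) :=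
    { toFun := fun a => (preGNSMul hf hb a).completion
      map_one' := hext _ _ fun b => by simp [hmul]
      map_mul' := fun a a' => hext _ _ fun b => by simp [hmul, mul_assoc]
      map_zero' := hext _ _ fun b => by simp [hmul, Completion.coe_zero]
      map_add' := fun a a' => hext _ _ fun b => by simp [hmul, add_mul, Completion.coe_add]
      commutes' := fun c => hext _ _ fun b => by
        simp [hmul, Algebra.algebraMap_eq_smul_one, Completion.coe_smul]
      map_star' := fun a => by
        rw [ContinuousLinearMap.star_eq_adjoint, ContinuousLinearMap.eq_adjoint_iff]
        intro x y
        induction x, y using Completion.induction_on₂ with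
        | hp => apply isClosed_eq <;> fun_prop
        | ih x y =>
          obtain ⟨b, rfl⟩ := (toPreGNS f hf).surjective x
          obtain ⟨c, rfl⟩ := (toPreGNS f hf).surjective y
          rw [hmul, hmul, Completion.inner_coe, Completion.inner_coe, preGNS_inner, preGNS_inner]
          simp [mul_assoc] }
  refine ⟨Completion (PreGNS f hf), inferInstance, inferInstance, inferInstance, π,
    (toPreGNS f hf 1 : PreGNS f hf), ?_, fun a => ?_⟩
  · have h1 : (fun a => π a (toPreGNS f hf 1 : PreGNS f hf)) =
        ((↑) : PreGNS f hf → Completion (PreGNS f hf)) ∘ toPreGNS f hf :=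
      funext fun a => (hmul a 1).trans (by simp)
    rw [h1]
    exact Completion.denseRange_coe.comp (toPreGNS f hf).surjective.denseRange
      (Completion.continuous_coe _)
  · change ⟪_, (preGNSMul hf hb a).completion _⟫_ℂ = _
    rw [hmul, Completion.inner_coe, preGNS_inner]
    simp

end GNS

/-! ### Intertwiners out of cyclic representations -/

section Intertwiner

variable {𝒜 : Type*} [Ring 𝒜] [StarRing 𝒜] [Algebra ℂ 𝒜]
variable {G : Type*} [NormedAddCommGroup G] [InnerProductSpace ℂ G] [CompleteSpace G]
variable {L : Type*} [NormedAddCommGroup L] [InnerProductSpace ℂ L] [CompleteSpace L]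

theorem norm_sq_apply_eq (ρ : 𝒜 →⋆ₐ[ℂ] (L →L[ℂ] L)) (ζ : L) (a : 𝒜) :
    ‖ρ a ζ‖ ^ 2 = (⟪ζ, ρ (star a * a) ζ⟫_ℂ).re := by
  rw [map_mul, map_star, mul_apply_eq_comp, ← inner_star_apply, star_star,
    ← inner_self_eq_norm_sq (𝕜 := ℂ)]
  rfl

theorem inner_apply_star_mul_self_nonneg (ρ : 𝒜 →⋆ₐ[ℂ] (L →L[ℂ] L)) (ζ : L) (a : 𝒜) :
    0 ≤ ⟪ζ, ρ (star a * a) ζ⟫_ℂ := by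
  rw [map_mul, map_star, mul_apply_eq_comp, ← inner_star_apply, star_star,
    inner_self_eq_norm_sq_to_K, ← RCLike.ofReal_pow]
  exact RCLike.ofReal_nonneg.2 (sq_nonneg _)

/-- Dominated vectors yield bounded intertwiners out of a cyclic representation. -/
theorem exists_intertwiner {π : 𝒜 →⋆ₐ[ℂ] (G →L[ℂ] G)} {Ω : G}
    (hΩ : DenseRange fun a => π a Ω) (ρ : 𝒜 →⋆ₐ[ℂ] (L →L[ℂ] L)) (ζ : L)
    (h : ∀ a, ‖ρ a ζ‖ ≤ ‖π a Ω‖) :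
    ∃ V : G →L[ℂ] L, V Ω = ζ ∧ ∀ a x, V (π a x) = ρ a (V x) := by
  let e : 𝒜 →ₗ[ℂ] G := (ContinuousLinearMap.apply ℂ G Ω).toLinearMap ∘ₗ π.toLinearMap
  let g : 𝒜 →ₗ[ℂ] L := (ContinuousLinearMap.apply ℂ L ζ).toLinearMap ∘ₗ ρ.toLinearMap
  have he : DenseRange e := hΩ
  have hV : ∀ a, g.extendOfNorm e (π a Ω) = ρ a ζ := fun a =>
    LinearMap.extendOfNorm_eq he ⟨1, fun a => (h a).trans_eq (one_mul _).symm⟩ a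
  refine ⟨g.extendOfNorm e, by simpa using hV 1, fun a x => ?_⟩
  induction x using hΩ.induction_on with
  | hp => apply isClosed_eq <;> fun_prop
  | ih b =>
    rw [hV, ← mul_apply_eq_comp, ← map_mul, hV, map_mul, mul_apply_eq_comp]

theorem adjoint_intertwines {π : 𝒜 →⋆ₐ[ℂ] (G →L[ℂ] G)} {ρ : 𝒜 →⋆ₐ[ℂ] (L →L[ℂ] L)}
    {V : G →L[ℂ] L} (hV : ∀ a x, V (π a x) = ρ a (V x)) (a : 𝒜) (y : L) :
    V.adjoint (ρ a y) = π a (V.adjoint y) := by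
  refine ext_inner_left ℂ fun x => ?_
  rw [ContinuousLinearMap.adjoint_inner_right, ← inner_star_apply, ← map_star, ← hV, map_star,
    ← ContinuousLinearMap.adjoint_inner_right, inner_star_apply]

theorem adjoint_comp_self_of_norm {V : G →L[ℂ] L} (h : ∀ x, ‖V x‖ = ‖x‖) (x : G) :
    V.adjoint (V x) = x := by
  have := (ContinuousLinearMap.norm_map_iff_adjoint_comp_self V).1 h
  exact congrArg (fun S : G →L[ℂ] G => S x) this

/-- If the vector functional of `ζ` is that of the cyclic vector, then the intertwiner is an
isometry. -/
theorem exists_isometric_intertwiner {π : 𝒜 →⋆ₐ[ℂ] (G →L[ℂ] G)} {Ω : G}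
    (hΩ : DenseRange fun a => π a Ω) (ρ : 𝒜 →⋆ₐ[ℂ] (L →L[ℂ] L)) (ζ : L)
    (h : ∀ a, ⟪ζ, ρ a ζ⟫_ℂ = ⟪Ω, π a Ω⟫_ℂ) :
    ∃ V : G →L[ℂ] L, V Ω = ζ ∧ (∀ a x, V (π a x) = ρ a (V x)) ∧ ∀ x, V.adjoint (V x) = x := by
  have hn : ∀ a, ‖ρ a ζ‖ = ‖π a Ω‖ := fun a => by
    refine (sq_eq_sq₀ (norm_nonneg _) (norm_nonneg _)).1 ?_
    rw [norm_sq_apply_eq, norm_sq_apply_eq, h]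
  obtain ⟨V, hVΩ, hV⟩ := exists_intertwiner hΩ ρ ζ fun a => (hn a).le
  refine ⟨V, hVΩ, hV, adjoint_comp_self_of_norm fun x => ?_⟩
  induction x using hΩ.induction_on with
  | hp => apply isClosed_eq <;> fun_prop
  | ih a => rw [hV, hVΩ, hn]

end Intertwiner

/-! ### A Radon–Nikodym theorem for positive functionals -/

section CStar

variable {A : Type*} [CStarAlgebra A]

/-- The positivity of `‖a‖² - a⋆ a`, in a form which does not mention the order. -/
theorem exists_star_mul_self_eq_norm_sub (a : A) :
    ∃ c : A, star c * c = algebraMap ℂ A ((‖a‖ : ℂ) ^ 2) - star a * a := by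
  let _ := CStarAlgebra.spectralOrder A
  have := CStarAlgebra.spectralOrderedRing A
  have h := CStarAlgebra.star_mul_le_algebraMap_norm_sq (a := a)
  obtain ⟨c, hc⟩ := CStarAlgebra.nonneg_iff_eq_star_mul_self.1 (sub_nonneg.2 h)
  refine ⟨c, hc.symm.trans ?_⟩
  congr 1
  simp [Algebra.algebraMap_eq_smul_one, ← Complex.ofReal_pow]

/-- Left multiplications on a C⋆-algebra are bounded for every positive functional. -/
theorem re_map_star_mul_mul_le {f : A →ₗ[ℂ] ℂ} (hf : ∀ a, 0 ≤ f (star a * a)) (a b : A) :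
    (f (star (a * b) * (a * b))).re ≤ ‖a‖ ^ 2 * (f (star b * b)).re := by
  obtain ⟨c, hc⟩ := exists_star_mul_self_eq_norm_sub a
  have h1 := (Complex.nonneg_iff.1 (hf (c * b))).1
  have h2 : star (c * b) * (c * b) =
      ((‖a‖ : ℂ) ^ 2) • (star b * b) - star (a * b) * (a * b) := by
    calc star (c * b) * (c * b) = star b * (star c * c) * b := by simp [mul_assoc]
      _ = _ := by
        rw [hc, Algebra.algebraMap_eq_smul_one]
        simp [mul_sub, sub_mul, mul_assoc]
  rw [h2, map_sub, map_smul, Complex.sub_re, smul_eq_mul, ← Complex.ofReal_pow,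
    Complex.re_ofReal_mul] at h1
  linarith

variable {H : Type*} [NormedAddCommGroup H] [InnerProductSpace ℂ H] [CompleteSpace H]

/-- A Radon–Nikodym theorem: a positive functional dominated by a vector functional of a
*-representation is itself a vector functional. -/
theorem exists_vector_of_le {f : A →ₗ[ℂ] ℂ} (hf : ∀ a, 0 ≤ f (star a * a))
    (ρ : A →⋆ₐ[ℂ] (H →L[ℂ] H)) (θ : H) (hθ : ∀ a, (f (star a * a)).re ≤ ‖ρ a θ‖ ^ 2) :
    ∃ ζ : H, ∀ a, f a = ⟪ζ, ρ a ζ⟫_ℂ := by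
  obtain ⟨G, _, _, _, π, Ω, hΩ, hπ⟩ := exists_gns hf
    fun a => ⟨‖a‖ ^ 2, re_map_star_mul_mul_le hf a⟩
  let f₀ : A →ₗ[ℂ] ℂ := (innerSL ℂ θ).toLinearMap ∘ₗ
    (ContinuousLinearMap.apply ℂ H θ).toLinearMap ∘ₗ ρ.toLinearMap
  have hf₀ : ∀ a, f₀ a = ⟪θ, ρ a θ⟫_ℂ := fun a => rfl
  have hf₀' : ∀ a, 0 ≤ f₀ (star a * a) := by
    intro a
    rw [hf₀]
    exact inner_apply_star_mul_self_nonneg ρ θ a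
  obtain ⟨G₀, _, _, _, π₀, Ω₀, hΩ₀, hπ₀⟩ := exists_gns hf₀'
    fun a => ⟨‖a‖ ^ 2, re_map_star_mul_mul_le hf₀' a⟩
  obtain ⟨V, hVΩ, hV, hVV⟩ := exists_isometric_intertwiner hΩ₀ ρ θ fun a => by rw [hπ₀, hf₀]
  obtain ⟨C, hCΩ, hC⟩ := exists_intertwiner hΩ₀ π Ω fun a => by
    refine le_of_sq_le_sq ?_ (norm_nonneg _)
    rw [norm_sq_apply_eq, hπ, norm_sq_apply_eq, hπ₀, hf₀, ← norm_sq_apply_eq]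
    exact hθ a
  -- the density `h = C⋆ C` commutes with `π₀`, and so does its square root
  let h : G₀ →L[ℂ] G₀ := C.adjoint ∘L C
  have hh : 0 ≤ h :=
    (ContinuousLinearMap.nonneg_iff_isPositive h).2 (ContinuousLinearMap.isPositive_adjoint_comp_self C)
  let r : G₀ →L[ℂ] G₀ := CFC.sqrt h
  have hrr : r * r = h := CFC.sqrt_mul_sqrt_self h hh
  have hr : ∀ a, Commute (π₀ a) r := by
    intro a
    have : Commute h (π₀ a) := by
      ext x
      simp only [h, mul_apply_eq_comp, ContinuousLinearMap.comp_apply, hC, adjoint_intertwines hC]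
    exact (this.cfcₙ_nnreal _).symm
  have hrs : ∀ x y, ⟪r x, y⟫_ℂ = ⟪x, r y⟫_ℂ := fun x y => by
    have : star r = r := (CFC.sqrt_nonneg h).isSelfAdjoint
    conv_lhs => rw [← this]
    exact inner_star_apply r x y
  refine ⟨V (r Ω₀), fun a => ?_⟩
  have e1 : π₀ a (r Ω₀) = r (π₀ a Ω₀) := congrArg (fun S : G₀ →L[ℂ] G₀ => S Ω₀) (hr a)
  have e2 : r (r (π₀ a Ω₀)) = C.adjoint (C (π₀ a Ω₀)) :=
    congrArg (fun S : G₀ →L[ℂ] G₀ => S (π₀ a Ω₀)) hrr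
  rw [← hV, ← ContinuousLinearMap.adjoint_inner_left, hVV, e1, hrs, e2,
    ContinuousLinearMap.adjoint_inner_right, hC, hCΩ, hπ]

end CStar

/-! ### Normal vector functionals -/

section NormalVector

variable {H : Type*} [NormedAddCommGroup H] [InnerProductSpace ℂ H] [CompleteSpace H]
variable {K : Type*} [NormedAddCommGroup K] [InnerProductSpace ℂ K] [CompleteSpace K]

/-- The representation `a ↦ a ⊗ 1` of a von Neumann algebra on `H ⊗ ℓ²`. -/
def ampRep (M : VonNeumannAlgebra H) : Alg M →⋆ₐ[ℂ] (L2 H →L[ℂ] L2 H) :=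
  (ampHom H).comp M.toStarSubalgebra.subtype

theorem ampRep_apply (M : VonNeumannAlgebra H) (a : Alg M) :
    ampRep M a = amp (a : H →L[ℂ] H) := rfl

/-- A normal positive functional is a vector functional of the amplification `a ↦ a ⊗ 1`: by
polarization it is dominated by one. -/
theorem exists_vector_of_continuous {M : VonNeumannAlgebra H} {f : Alg M →ₗ[ℂ] ℂ}
    (hf : ∀ a, 0 ≤ f (star a * a)) (hc : @Continuous _ _ (ultraweak M) inferInstance f) :
    ∃ ζ : L2 H, ∀ a : Alg M, f a = ⟪ζ, ampRep M a ζ⟫_ℂ := by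
  obtain ⟨ξ, η, h⟩ := exists_inner_amp_of_continuous f hc
  refine exists_vector_of_le hf (ampRep M) ((1 / 2 : ℂ) • (ξ + η)) fun a => ?_
  have h1 : f (star a * a) = ⟪ampRep M a ξ, ampRep M a η⟫_ℂ := by
    rw [h, ← ampRep_apply, map_mul, map_star, mul_apply_eq_comp, ← inner_star_apply, star_star]
  rw [h1, map_smul, map_add, norm_smul, mul_pow]
  have h2 := norm_add_sq (𝕜 := ℂ) (ampRep M a ξ) (ampRep M a η)
  have h3 := norm_sub_sq (𝕜 := ℂ) (ampRep M a ξ) (ampRep M a η)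
  have h4 := sq_nonneg ‖ampRep M a ξ - ampRep M a η‖
  norm_num at h2 h3 ⊢
  linarith

theorem NormalState.exists_vector {M : VonNeumannAlgebra H} (ω : NormalState M) :
    ∃ ζ : L2 H, ∀ a : Alg M, ω.toCLM a = ⟪ζ, ampRep M a ζ⟫_ℂ :=
  exists_vector_of_continuous (f := ω.toCLM.toLinearMap) ω.nonneg' ω.normal'

/-- A vector in the space of a *-representation of a von Neumann algebra is normal if its vector
functional is a vector functional of the amplification of the algebra. -/
def IsNormalVector {M : VonNeumannAlgebra H} (ρ : Alg M →⋆ₐ[ℂ] (K →L[ℂ] K)) (x : K) : Prop :=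
  ∃ ζ : L2 H, ∀ a : Alg M, ⟪x, ρ a x⟫_ℂ = ⟪ζ, ampRep M a ζ⟫_ℂ

/-- The Cauchy–Schwarz inequality with the weights `2 ^ (i + 1)`, whose inverses sum to `1`. -/
theorem norm_sq_sum_range_le {E : Type*} [SeminormedAddCommGroup E] (n : ℕ) (w : ℕ → E) :
    ‖∑ i ∈ Finset.range n, w i‖ ^ 2 ≤ ∑ i ∈ Finset.range n, 2 ^ (i + 1) * ‖w i‖ ^ 2 := by
  induction n generalizing w with
  | zero => simp
  | succ n ih =>
    rw [Finset.sum_range_succ', Finset.sum_range_succ']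
    have h1 := ih fun i => w (i + 1)
    have h2 : ∑ i ∈ Finset.range n, 2 ^ (i + 1 + 1) * ‖w (i + 1)‖ ^ 2 =
        2 * ∑ i ∈ Finset.range n, 2 ^ (i + 1) * ‖w (i + 1)‖ ^ 2 := by
      rw [Finset.mul_sum]
      exact Finset.sum_congr rfl fun i _ => by ring
    have h3 : ‖(∑ i ∈ Finset.range n, w (i + 1)) + w 0‖ ^ 2 ≤
        (‖∑ i ∈ Finset.range n, w (i + 1)‖ + ‖w 0‖) ^ 2 := by
      gcongr
      exact norm_add_le _ _
    rw [h2]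
    have h4 := sq_nonneg (‖∑ i ∈ Finset.range n, w (i + 1)‖ - ‖w 0‖)
    simp only [zero_add, pow_one]
    nlinarith

theorem norm_sq_amp_flatten (a : H →L[ℂ] H) (Θ : L2 (L2 H)) :
    ‖amp a (flatten Θ)‖ ^ 2 = ‖amp (amp a) Θ‖ ^ 2 := by
  have h1 := norm_sq_apply_eq (ampHom H) (flatten Θ) a
  have h2 := norm_sq_apply_eq ((ampHom (L2 H)).comp (ampHom H)) Θ a
  simp only [StarAlgHom.comp_apply, ampHom_apply] at h1 h2
  rw [h1, h2, inner_flatten]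

/-- Vectors are normal as soon as those of a dense subgroup are.  A vector `x` is written as a
series of vectors `v i` of the subgroup with rapidly decreasing norms, so that its functional is
dominated by `∑ i, 2 ^ (i + 1) ⟪v i, ρ (·) (v i)⟫`. -/
theorem isNormalVector_of_dense {M : VonNeumannAlgebra H} {ρ : Alg M →⋆ₐ[ℂ] (K →L[ℂ] K)}
    (D : AddSubgroup K) (hD : Dense (D : Set K)) (h : ∀ x ∈ D, IsNormalVector ρ x) (x : K) :
    IsNormalVector ρ x := by
  obtain ⟨w, hw, hwD, -, hwn⟩ := controlled_sum_of_mem_closure (hD x)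
    (b := fun n => (1 / 2 : ℝ) ^ n) fun n => by positivity
  choose ζ hζ using fun n => h (w n) (hwD n)
  have hζn : ∀ n a, ‖ampRep M a (ζ n)‖ = ‖ρ a (w n)‖ := fun n a => by
    refine (sq_eq_sq₀ (norm_nonneg _) (norm_nonneg _)).1 ?_
    rw [norm_sq_apply_eq, norm_sq_apply_eq, hζ]
  have hmem : Memℓp (fun n : ℕ => ((√(2 ^ (n + 1)) : ℝ) : ℂ) • ζ n) 2 := by
    have h2 : (0 : ℝ) < (2 : ENNReal).toReal := by norm_num
    refine (memℓp_gen_iff h2).2 ?_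
    have hs : Summable fun n : ℕ => (2 : ℝ) * (1 / 2) ^ n :=
      (summable_geometric_of_lt_one (by norm_num) (by norm_num)).mul_left 2
    refine Summable.of_norm_bounded_eventually_nat hs ?_
    filter_upwards [Filter.eventually_gt_atTop 0] with n hn
    have hz : ‖ζ n‖ < (1 / 2) ^ n := by simpa using (hζn n 1).trans_lt (by simpa using hwn n hn)
    have e : ((2 : ENNReal).toReal) = ((2 : ℕ) : ℝ) := by norm_num
    rw [e, Real.rpow_natCast, norm_smul, mul_pow, Complex.norm_real, norm_mul, norm_pow, norm_pow,
      norm_norm, norm_norm, ← norm_pow, Real.sq_sqrt (by positivity), norm_pow, Real.norm_ofNat]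
    calc (2 : ℝ) ^ (n + 1) * ‖ζ n‖ ^ 2 ≤ 2 ^ (n + 1) * ((1 / 2) ^ n) ^ 2 := by gcongr
      _ = 2 * (1 / 2) ^ n := by
        rw [pow_succ, sq, one_div, inv_pow]
        field_simp
  let Θ : L2 (L2 H) := ⟨fun n => ((√(2 ^ (n + 1)) : ℝ) : ℂ) • ζ n, hmem⟩
  let f : Alg M →ₗ[ℂ] ℂ := (innerSL ℂ x).toLinearMap ∘ₗ
    (ContinuousLinearMap.apply ℂ K x).toLinearMap ∘ₗ ρ.toLinearMap
  refine exists_vector_of_le (f := f) (fun a => inner_apply_star_mul_self_nonneg ρ x a)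
    (ampRep M) (flatten Θ) fun a => ?_
  change (⟪x, ρ (star a * a) x⟫_ℂ).re ≤ _
  rw [← norm_sq_apply_eq, ampRep_apply, norm_sq_amp_flatten]
  have hlim : Filter.Tendsto (fun n => ‖∑ i ∈ Finset.range (n + 1), ρ a (w i)‖ ^ 2) Filter.atTop
      (nhds (‖ρ a x‖ ^ 2)) := by
    have := (((ρ a).continuous.tendsto x).comp hw).norm.pow 2
    simpa [Function.comp_def, map_sum] using this
  refine le_of_tendsto' hlim fun n => (norm_sq_sum_range_le _ _).trans ?_
  have e : ((2 : ENNReal).toReal) = ((2 : ℕ) : ℝ) := by norm_num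
  have hle := lp.sum_rpow_le_norm_rpow (p := 2) (by norm_num) (amp (amp (a : H →L[ℂ] H)) Θ)
    (Finset.range (n + 1))
  rw [e] at hle
  simp only [Real.rpow_natCast] at hle
  refine le_trans (le_of_eq (Finset.sum_congr rfl fun i _ => ?_)) hle
  have e2 : (amp (amp (a : H →L[ℂ] H)) Θ) i =
      ((√(2 ^ (i + 1)) : ℝ) : ℂ) • ampRep M a (ζ i) := by
    rw [amp_apply, ← ampRep_apply, ← map_smul]
  rw [e2, norm_smul, mul_pow, Complex.norm_real, ← norm_pow, Real.sq_sqrt (by positivity), hζn]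
  simp

theorem isNormalVector_amp {M : VonNeumannAlgebra H} {ρ : Alg M →⋆ₐ[ℂ] (K →L[ℂ] K)}
    (h : ∀ x, IsNormalVector ρ x) (ξ : L2 K) :
    IsNormalVector ((ampHom K).comp ρ) ξ := by
  choose ζ hζ using h
  have hζn : ∀ x, ‖ζ x‖ = ‖x‖ := fun x => by
    refine (sq_eq_sq₀ (norm_nonneg _) (norm_nonneg _)).1 ?_
    have h1 := norm_sq_apply_eq (ampRep M) (ζ x) 1
    have h2 := norm_sq_apply_eq ρ x 1
    rw [← hζ, ← h2] at h1
    simpa using h1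
  let Θ : L2 (L2 H) := ⟨fun n => ζ (ξ n), (lp.memℓp ξ).mono' fun n => (hζn _).le⟩
  refine ⟨flatten Θ, fun a => ?_⟩
  rw [ampRep_apply, inner_flatten, inner_amp, StarAlgHom.comp_apply, ampHom_apply, inner_amp]
  exact tsum_congr fun k => hζ (ξ k) a

/-- A *-morphism of von Neumann algebras all of whose vector functionals are normal is normal, by
polarization. -/
theorem isNormalHom_of_isNormalVector {M : VonNeumannAlgebra H} {R : VonNeumannAlgebra K}
    (j : Alg M →⋆ₐ[ℂ] Alg R)
    (h : ∀ x, IsNormalVector (R.toStarSubalgebra.subtype.comp j) x) : IsNormalHom j := by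
  refine @continuous_ultraweak_rng _ _ _ _ _ (ultraweak M) R j fun ξ η => ?_
  let T : Alg M → L2 K →L[ℂ] L2 K := fun a => amp (j a : K →L[ℂ] K)
  have hd : ∀ x : L2 K, @Continuous _ _ (ultraweak M) inferInstance fun a => ⟪x, T a x⟫_ℂ := by
    intro x
    obtain ⟨ζ, hζ⟩ := isNormalVector_amp h x
    convert continuous_ultraweak_inner_amp M ζ ζ using 2 with a
    exact hζ a
  have hpol : (fun a => ⟪ξ, T a η⟫_ℂ) = fun a =>
      (⟪ξ + η, T a (ξ + η)⟫_ℂ - ⟪ξ - η, T a (ξ - η)⟫_ℂ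
        - Complex.I * ⟪ξ + Complex.I • η, T a (ξ + Complex.I • η)⟫_ℂ
        + Complex.I * ⟪ξ - Complex.I • η, T a (ξ - Complex.I • η)⟫_ℂ) / 4 := by
    funext a
    have := inner_map_polarization' (star (T a) : L2 K →L[ℂ] L2 K).toLinearMap ξ η
    simpa only [ContinuousLinearMap.coe_coe, inner_star_apply] using this
  change @Continuous _ _ (ultraweak M) _ fun a => ⟪ξ, T a η⟫_ℂ
  rw [hpol]
  let _ := ultraweak M
  have h1 := hd (ξ + η)
  have h2 := hd (ξ - η)
  have h3 := hd (ξ + Complex.I • η)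
  have h4 := hd (ξ - Complex.I • η)
  exact (((h1.sub h2).sub (continuous_const.mul h3)).add (continuous_const.mul h4)).div_const 4

/-- The vector functionals of the amplification are normal. -/
theorem continuous_comp_of_isNormalHom {M : VonNeumannAlgebra H} {R : VonNeumannAlgebra K}
    {j : Alg M →⋆ₐ[ℂ] Alg R} (hj : IsNormalHom j) (ξ η : L2 K) :
    @Continuous _ _ (ultraweak M) inferInstance fun a => ⟪ξ, ampRep R (j a) η⟫_ℂ :=
  @Continuous.comp _ _ _ (ultraweak M) (ultraweak R) _ _ _ (continuous_ultraweak_inner_amp R ξ η) hj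

end NormalVector

/-! ### Generated von Neumann algebras -/

section Generated

variable {H : Type*} [NormedAddCommGroup H] [InnerProductSpace ℂ H] [CompleteSpace H]

theorem mem_vnGen_iff {X : Set (H →L[ℂ] H)} {b : H →L[ℂ] H} :
    b ∈ vnGen X ↔ ∀ T : H →L[ℂ] H, (∀ x ∈ X, x * T = T * x) → (∀ x ∈ X, star x * T = T * star x) →
      T * b = b * T := by
  change b ∈ StarSubalgebra.centralizer ℂ
    (StarSubalgebra.centralizer ℂ X : Set (H →L[ℂ] H)) ↔ _
  rw [StarSubalgebra.mem_centralizer_iff]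
  constructor
  · intro h T h1 h2
    exact (h T ((StarSubalgebra.mem_centralizer_iff ℂ).2 fun x hx => ⟨h1 x hx, h2 x hx⟩)).1
  · intro h T hT
    have key : ∀ T ∈ StarSubalgebra.centralizer ℂ X, T * b = b * T := fun T hT =>
      h T (fun x hx => ((StarSubalgebra.mem_centralizer_iff ℂ).1 hT x hx).1)
        fun x hx => ((StarSubalgebra.mem_centralizer_iff ℂ).1 hT x hx).2
    exact ⟨key T hT, key _ (star_mem hT)⟩

theorem mem_vnGen {X : Set (H →L[ℂ] H)} {x : H →L[ℂ] H} (hx : x ∈ X) : x ∈ vnGen X :=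
  subset_vnGen X hx

theorem vnGen_le {X : Set (H →L[ℂ] H)} {M : VonNeumannAlgebra H} (h : ∀ x ∈ X, x ∈ M)
    {b : H →L[ℂ] H} (hb : b ∈ vnGen X) : b ∈ M := by
  rw [← M.commutant_commutant, VonNeumannAlgebra.mem_commutant_iff]
  intro T hT
  rw [VonNeumannAlgebra.mem_commutant_iff] at hT
  exact mem_vnGen_iff.1 hb T (fun x hx => hT x (h x hx)) fun x hx => hT _ (star_mem (h x hx))

theorem mul_starProjection_comm {E : Submodule ℂ H} [E.HasOrthogonalProjection] {s : H →L[ℂ] H}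
    (h : ∀ w ∈ E, s w ∈ E) (h' : ∀ w ∈ E, star s w ∈ E) :
    s * E.starProjection = E.starProjection * s := by
  ext w
  simp only [mul_apply_eq_comp]
  symm
  refine Submodule.eq_starProjection_of_mem_of_inner_eq_zero
    (h _ (Submodule.starProjection_apply_mem _ _)) fun v hv => ?_
  have h1 := Submodule.starProjection_inner_eq_zero (K := E) w _ (h' v hv)
  rwa [← map_sub, ← star_star s, inner_star_apply]

variable {𝒜 : Type*} [Ring 𝒜] [StarRing 𝒜] [Algebra ℂ 𝒜]

theorem mem_vnGen_image_iff {ρ : 𝒜 →⋆ₐ[ℂ] (H →L[ℂ] H)} {B : Set 𝒜} (hB : ∀ a ∈ B, star a ∈ B)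
    {b : H →L[ℂ] H} :
    b ∈ vnGen (ρ '' B) ↔ ∀ T : H →L[ℂ] H, (∀ a ∈ B, ρ a * T = T * ρ a) → T * b = b * T := by
  rw [mem_vnGen_iff]
  constructor
  · intro h T hT
    refine h T (Set.forall_mem_image.2 hT) (Set.forall_mem_image.2 fun a ha => ?_)
    rw [← map_star]
    exact hT _ (hB a ha)
  · intro h T hT _
    exact h T fun a ha => hT _ (Set.mem_image_of_mem _ ha)

end Generated

/-! ### Quasi-equivalence with a cyclic representation -/

section QuasiEquivalence

variable {𝒜 : Type*} [Ring 𝒜] [StarRing 𝒜] [Algebra ℂ 𝒜]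
variable {L : Type*} [NormedAddCommGroup L] [InnerProductSpace ℂ L] [CompleteSpace L]
variable {K : Type*} [NormedAddCommGroup K] [InnerProductSpace ℂ K] [CompleteSpace K]

/-- A bounded operator `T` between the spaces of two *-representations intertwines them. -/
def Intertwines (π : 𝒜 →⋆ₐ[ℂ] (L →L[ℂ] L)) (ρ : 𝒜 →⋆ₐ[ℂ] (K →L[ℂ] K)) (T : L →L[ℂ] K) : Prop :=
  ∀ a x, T (π a x) = ρ a (T x)

variable {π : 𝒜 →⋆ₐ[ℂ] (L →L[ℂ] L)} {ρ : 𝒜 →⋆ₐ[ℂ] (K →L[ℂ] K)}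

/-- `S⋆ s T` is in the commutant of `π(B)` if `S`, `T` are intertwiners and `s` is in the commutant
of `ρ(B)`. -/
theorem adjoint_mul_mul_commute {B : Set 𝒜} {S T : L →L[ℂ] K} (hS : Intertwines π ρ S)
    (hT : Intertwines π ρ T) {s : K →L[ℂ] K} (hs : ∀ a ∈ B, ρ a * s = s * ρ a) :
    ∀ a ∈ B, π a * (S.adjoint ∘L s ∘L T) = (S.adjoint ∘L s ∘L T) * π a := by
  intro a ha
  ext x
  simp only [mul_apply_eq_comp, ContinuousLinearMap.comp_apply]
  rw [hT, ← mul_apply_eq_comp s, ← hs a ha, mul_apply_eq_comp, adjoint_intertwines hS]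

/-- The operator `V⋆ (b ⊗ 1) V` on the space of `π`. -/
def compress (V : L →L[ℂ] L2 K) (b : K →L[ℂ] K) : L →L[ℂ] L := V.adjoint ∘L amp b ∘L V

theorem compress_apply (V : L →L[ℂ] L2 K) (b : K →L[ℂ] K) (x : L) :
    compress V b x = V.adjoint (amp b (V x)) := rfl

section Compress

variable {V : L →L[ℂ] L2 K} (hV : Intertwines π ((ampHom K).comp ρ) V)
  (hVV : ∀ x, V.adjoint (V x) = x)
include hV

/-- If `s` commutes with `π(B)`, then `V s V⋆` commutes with `ρ(B)'' ⊗ 1`. -/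
theorem amp_comm_conj {B : Set 𝒜} (hB : ∀ a ∈ B, star a ∈ B) {s : L →L[ℂ] L}
    (hs : ∀ a ∈ B, π a * s = s * π a) {b : K →L[ℂ] K} (hb : b ∈ vnGen (ρ '' B)) (y : L2 K) :
    V (s (V.adjoint (amp b y))) = amp b (V (s (V.adjoint y))) := by
  have aux : ∀ a ∈ B, (V ∘L s ∘L V.adjoint) * amp (ρ a) = amp (ρ a) * (V ∘L s ∘L V.adjoint) := by
    intro a ha
    ext1 y
    have h1 : V.adjoint (amp (ρ a) y) = π a (V.adjoint y) := adjoint_intertwines hV a y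
    have h2 : ∀ x, V (π a x) = amp (ρ a) (V x) := hV a
    simp only [mul_apply_eq_comp, ContinuousLinearMap.comp_apply]
    rw [h1, ← mul_apply_eq_comp s, ← hs a ha, mul_apply_eq_comp, h2]
  have := amp_commute_of_mem_vnGen hb (T := V ∘L s ∘L V.adjoint) (Set.forall_mem_image.2 aux)
    (Set.forall_mem_image.2 fun a ha => by rw [← map_star]; exact aux _ (hB a ha))
  exact congrArg (fun S : L2 K →L[ℂ] L2 K => S y) this

include hVV

theorem compress_intertwines {b : K →L[ℂ] K} (hb : b ∈ vnGen (Set.range ρ)) (x : L) :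
    V (compress V b x) = amp b (V x) := by
  have := amp_comm_conj hV (B := Set.univ) (fun _ _ => trivial) (s := 1)
    (fun _ _ => by rw [mul_one, one_mul]) (Set.image_univ ▸ hb) (V x)
  simpa [compress_apply, hVV] using this

/-- Elements of `ρ(𝒜)''` act through their compressions on the range of each intertwiner. -/
theorem apply_intertwiner {b : K →L[ℂ] K} (hb : b ∈ vnGen (Set.range ρ)) {T : L →L[ℂ] K}
    (hT : Intertwines π ρ T) (x : L) : b (T x) = T (compress V b x) := by
  have aux : ∀ a : 𝒜, (slot 0 ∘L T ∘L V.adjoint) * amp (ρ a) =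
      amp (ρ a) * (slot 0 ∘L T ∘L V.adjoint) := by
    intro a
    ext1 y
    have h1 : V.adjoint (amp (ρ a) y) = π a (V.adjoint y) := adjoint_intertwines hV a y
    simp only [mul_apply_eq_comp, ContinuousLinearMap.comp_apply]
    rw [h1, hT, amp_slot]
  have := amp_commute_of_mem_vnGen hb (T := slot 0 ∘L T ∘L V.adjoint)
    (Set.forall_mem_range.2 aux)
    (Set.forall_mem_range.2 fun a => by rw [← map_star]; exact aux _)
  have h2 := congrArg (fun S : L2 K →L[ℂ] L2 K => S (V x) 0) this
  simpa [hVV, compress_apply, amp_slot] using h2.symm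

theorem compress_mem {B : Set 𝒜} (hB : ∀ a ∈ B, star a ∈ B) {b : K →L[ℂ] K}
    (hb : b ∈ vnGen (ρ '' B)) : compress V b ∈ vnGen (π '' B) := by
  refine (mem_vnGen_image_iff hB).2 fun s hs => ?_
  ext x
  have := congrArg V.adjoint (amp_comm_conj hV hB hs hb (V x))
  simpa [compress_apply, hVV] using this

/-- The *-morphism `b ↦ V⋆ (b ⊗ 1) V` from `ρ(𝒜)''` to `π(𝒜)''`. -/
def compressHom : Alg (vnGen (Set.range ρ)) →⋆ₐ[ℂ] Alg (vnGen (Set.range π)) where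
  toFun b := ⟨compress V (b : K →L[ℂ] K), by
    have := compress_mem hV hVV (B := Set.univ) (fun _ _ => trivial)
      (b := (b : K →L[ℂ] K)) (by rw [Set.image_univ]; exact b.2)
    rwa [Set.image_univ] at this⟩
  map_one' := Subtype.ext <| by ext x; simp [compress_apply, hVV]
  map_mul' b c := Subtype.ext <| by
    ext x
    have := compress_intertwines hV hVV c.2 x
    simp [compress_apply] at this ⊢
    rw [this]
  map_zero' := Subtype.ext <| by ext x; simp [compress_apply]
  map_add' b c := Subtype.ext <| by ext x; simp [compress_apply]
  commutes' c := Subtype.ext <| by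
    ext x; simp [compress_apply, Algebra.algebraMap_eq_smul_one, hVV]
  map_star' b := Subtype.ext <| by
    ext x
    refine ext_inner_left ℂ fun y => ?_
    change ⟪y, compress V (star (b : K →L[ℂ] K)) x⟫_ℂ = ⟪y, star (compress V b) x⟫_ℂ
    rw [← inner_star_apply (star (compress V (b : K →L[ℂ] K))), star_star, compress_apply,
      compress_apply, amp_star, ContinuousLinearMap.adjoint_inner_right,
      ContinuousLinearMap.adjoint_inner_left, ← inner_star_apply, star_star]

end Compress

section Extend

variable (π ρ)

/-- The sum `∑ T z u_T` over a finitely supported family `u` of vectors indexed by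
intertwiners. -/
def interSum (z : L →L[ℂ] L) : ({T : L →L[ℂ] K // Intertwines π ρ T} →₀ L) →ₗ[ℂ] K :=
  Finsupp.lsum ℂ fun T => (T.1 ∘L z).toLinearMap

variable {π ρ}

theorem interSum_single (z : L →L[ℂ] L) (T : {T : L →L[ℂ] K // Intertwines π ρ T}) (x : L) :
    interSum π ρ z (Finsupp.single T x) = T.1 (z x) := by
  simp [interSum]

/-- Elements of `π(B)''` can be moved across intertwiners inside inner products, because
`S⋆ s T` is in the commutant of `π(B)`. -/
theorem inner_intertwiner {S T : L →L[ℂ] K} (hS : Intertwines π ρ S) (hT : Intertwines π ρ T)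
    {B : Set 𝒜} (hB : ∀ a ∈ B, star a ∈ B) {z : L →L[ℂ] L} (hz : z ∈ vnGen (π '' B))
    {s : K →L[ℂ] K} (hs : ∀ a ∈ B, ρ a * s = s * ρ a) (x y : L) :
    ⟪s (T (z x)), S y⟫_ℂ = ⟪s (T x), S (star z y)⟫_ℂ := by
  have h1 := (mem_vnGen_image_iff hB).1 hz _ (adjoint_mul_mul_commute hS hT hs)
  have h2 := congrArg (fun R : L →L[ℂ] L => ⟪R x, y⟫_ℂ) h1
  simp only [mul_apply_eq_comp, ContinuousLinearMap.comp_apply,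
    ContinuousLinearMap.adjoint_inner_left] at h2
  rw [h2, ← ContinuousLinearMap.adjoint_inner_left, ← inner_star_apply, star_star]

theorem inner_interSum {z w : L →L[ℂ] L} (hz : z ∈ vnGen (Set.range π))
    (u u' : {T : L →L[ℂ] K // Intertwines π ρ T} →₀ L) :
    ⟪interSum π ρ z u, interSum π ρ w u'⟫_ℂ =
      ⟪interSum π ρ 1 u, interSum π ρ (star z * w) u'⟫_ℂ := by
  induction u using Finsupp.induction_linear with
  | zero => simp
  | add u v hu hv => simp only [map_add, inner_add_left, hu, hv]
  | single T x =>
    induction u' using Finsupp.induction_linear with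
    | zero => simp
    | add u v hu hv => simp only [map_add, inner_add_right, hu, hv]
    | single S y =>
      simp only [interSum_single]
      exact inner_intertwiner S.2 T.2 (B := Set.univ) (fun _ _ => trivial)
        (Set.image_univ ▸ hz) (s := 1) (fun _ _ => by rw [mul_one, one_mul]) x (w y)

theorem eq_of_intertwiners (hd : DenseRange (interSum π ρ 1)) {R S : K →L[ℂ] K}
    (h : ∀ T, Intertwines π ρ T → ∀ x, R (T x) = S (T x)) : R = S := by
  ext w
  induction w using hd.induction_on with
  | hp => apply isClosed_eq <;> fun_prop
  | ih u =>
    induction u using Finsupp.induction_linear with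
    | zero => simp
    | add u v hu hv => simp only [map_add, hu, hv]
    | single T x => simpa only [interSum_single, one_apply_eq_self] using h _ T.2 x

/-- If the ranges of the intertwiners span a dense subspace, each `x ∈ π(𝒜)''` is carried to an
operator `y` with `y T = T x` for all intertwiners `T`. -/
theorem exists_extend (hd : DenseRange (interSum π ρ 1)) {z : L →L[ℂ] L}
    (hz : z ∈ vnGen (Set.range π)) :
    ∃ y : K →L[ℂ] K, ∀ T, Intertwines π ρ T → ∀ x, y (T x) = T (z x) := by
  obtain ⟨c, hc⟩ := exists_star_mul_self_eq_norm_sub (A := Alg (vnGen (Set.range π))) ⟨z, hz⟩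
  have hc' : star (c : L →L[ℂ] L) * c = ((‖z‖ : ℂ) ^ 2) • 1 - star z * z := by
    have := congrArg (Subtype.val) hc
    simpa [Algebra.algebraMap_eq_smul_one] using this
  have hbound : ∀ u, ‖interSum π ρ z u‖ ≤ ‖z‖ * ‖interSum π ρ 1 u‖ := by
    intro u
    refine le_of_sq_le_sq ?_ (by positivity)
    have h1 := inner_interSum (w := (c : L →L[ℂ] L)) c.2 u u
    have h2 := inner_interSum (w := z) hz u u
    have h3 : interSum π ρ (star (c : L →L[ℂ] L) * c) u =
        ((‖z‖ : ℂ) ^ 2) • interSum π ρ 1 u - interSum π ρ (star z * z) u := by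
      rw [hc']
      clear h1 h2
      induction u using Finsupp.induction_linear with
      | zero => simp
      | add u v hu hv => simp only [map_add, smul_add, hu, hv]; abel
      | single T x => simp [interSum_single]
    rw [h3, inner_sub_right, ← h2, inner_smul_right, inner_self_eq_norm_sq_to_K,
      inner_self_eq_norm_sq_to_K, inner_self_eq_norm_sq_to_K] at h1
    have h4 : ‖interSum π ρ (c : L →L[ℂ] L) u‖ ^ 2 =
        ‖z‖ ^ 2 * ‖interSum π ρ 1 u‖ ^ 2 - ‖interSum π ρ z u‖ ^ 2 :=
      Complex.ofReal_injective (by simpa using h1)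
    nlinarith [sq_nonneg ‖interSum π ρ (c : L →L[ℂ] L) u‖]
  refine ⟨(interSum π ρ z).extendOfNorm (interSum π ρ 1), fun T hT x => ?_⟩
  have := LinearMap.extendOfNorm_eq hd ⟨‖z‖, hbound⟩ (Finsupp.single ⟨T, hT⟩ x)
  simpa only [interSum_single, one_apply_eq_self] using this

/-- The operator carried over from an element of `π(B)''` belongs to `ρ(B)''`. -/
theorem extend_mem (hd : DenseRange (interSum π ρ 1)) {B : Set 𝒜} (hB : ∀ a ∈ B, star a ∈ B)
    {z : L →L[ℂ] L} (hz : z ∈ vnGen (π '' B)) {y : K →L[ℂ] K}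
    (hy : ∀ T, Intertwines π ρ T → ∀ x, y (T x) = T (z x)) : y ∈ vnGen (ρ '' B) := by
  have hadj : ∀ S, Intertwines π ρ S → ∀ x, y.adjoint (S x) = S (star z x) := by
    intro S hS x
    refine ext_inner_left ℂ fun w => ?_
    rw [ContinuousLinearMap.adjoint_inner_right]
    induction w using hd.induction_on with
    | hp => apply isClosed_eq <;> fun_prop
    | ih u =>
      induction u using Finsupp.induction_linear with
      | zero => simp
      | add u v hu hv => simp only [map_add, inner_add_left, hu, hv]
      | single T w =>
        rw [interSum_single, hy _ T.2]
        exact inner_intertwiner hS T.2 hB hz (s := 1) (fun _ _ => by rw [mul_one, one_mul]) w x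
  refine (mem_vnGen_image_iff hB).2 fun s hs => ?_
  refine eq_of_intertwiners hd fun T hT x => ?_
  simp only [mul_apply_eq_comp]
  rw [hy T hT]
  refine ext_inner_right ℂ fun w => ?_
  induction w using hd.induction_on with
  | hp => apply isClosed_eq <;> fun_prop
  | ih u =>
    induction u using Finsupp.induction_linear with
    | zero => simp
    | add u v hu hv => simp only [map_add, inner_add_right, hu, hv]
    | single S w =>
      rw [interSum_single, ← ContinuousLinearMap.adjoint_inner_right y, hadj _ S.2]
      exact inner_intertwiner S.2 hT hB hz hs x w

end Extend

/-- If a state of `ρ(𝒜)''` has central support `1` and is implemented by an intertwiner from `π` to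
the amplification of `ρ`, then the ranges of the intertwiners from `π` to `ρ` span a dense subspace:
the projection onto its closure is central. -/
theorem denseRange_interSum {V : L →L[ℂ] L2 K} (hV : Intertwines π ((ampHom K).comp ρ) V) {Ω : L}
    (σ : NormalState (vnGen (Set.range ρ)))
    (hσ : ∀ b, σ.toCLM b = ⟪V Ω, ampRep (vnGen (Set.range ρ)) b (V Ω)⟫_ℂ)
    (hσ1 : σ.CentralSupportEqOne) : DenseRange (interSum π ρ 1) := by
  let E : Submodule ℂ K := (LinearMap.range (interSum π ρ 1)).topologicalClosure
  have hinv : ∀ s : K →L[ℂ] K, (∀ T, Intertwines π ρ T → ∀ x, s (T x) ∈ E) →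
      ∀ w ∈ E, s w ∈ E := by
    intro s hs w hw
    have h1 : LinearMap.range (interSum π ρ 1) ≤ E.comap s.toLinearMap := by
      rintro _ ⟨u, rfl⟩
      induction u using Finsupp.induction_linear with
      | zero => simp
      | add u v hu hv => rw [map_add]; exact add_mem hu hv
      | single T x => rw [interSum_single]; exact hs _ T.2 x
    have h2 : IsClosed (E.comap s.toLinearMap : Set K) :=
      (Submodule.isClosed_topologicalClosure _).preimage s.continuous
    exact Submodule.topologicalClosure_minimal _ h1 h2 hw
  have hTE : ∀ T, Intertwines π ρ T → ∀ x, T x ∈ E := fun T hT x =>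
    Submodule.le_topologicalClosure _ ⟨Finsupp.single ⟨T, hT⟩ x, by rw [interSum_single]; rfl⟩
  have hproj : IsStarProjection E.starProjection := isStarProjection_starProjection
  have hmem : E.starProjection ∈ vnGen (Set.range ρ) := by
    refine mem_vnGen_iff.2 fun s hs hs' => ?_
    have aux : ∀ s : K →L[ℂ] K, (∀ a, ρ a * s = s * ρ a) → ∀ w ∈ E, s w ∈ E := by
      intro s hs
      refine hinv s fun T hT x => hTE (s ∘L T) (fun a x => ?_) x
      rw [ContinuousLinearMap.comp_apply, hT, ← mul_apply_eq_comp, ← hs]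
      rfl
    refine mul_starProjection_comm (aux s fun a => hs _ ⟨a, rfl⟩) (aux _ fun a => ?_)
    have := congrArg star (hs' _ ⟨a, rfl⟩)
    simpa using this.symm
  have hρ : ∀ a, ∀ w ∈ E, ρ a w ∈ E := fun a => hinv _ fun T hT x => by
    rw [← hT]
    exact hTE T hT _
  have hcomm : ∀ b ∈ vnGen (Set.range ρ), E.starProjection * b = b * E.starProjection := by
    intro b hb
    refine mem_vnGen_iff.1 hb _ (Set.forall_mem_range.2 fun a => ?_)
      (Set.forall_mem_range.2 fun a => ?_)
    · exact mul_starProjection_comm (hρ a) (by rw [← map_star]; exact hρ _)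
    · rw [← map_star]
      exact mul_starProjection_comm (hρ _) (by rw [← map_star]; exact hρ _)
  have hone : (⟨E.starProjection, hmem⟩ : Alg (vnGen (Set.range ρ))) = 1 := by
    refine hσ1 _ ⟨Subtype.ext hproj.1, Subtype.ext hproj.2⟩
      (fun b => Subtype.ext (hcomm _ b.2)) ?_
    rw [← σ.map_one', hσ, hσ]
    congr 1
    ext k
    rw [ampRep_apply, ampRep_apply, amp_apply, amp_apply]
    exact Submodule.starProjection_eq_self_iff.2 (hTE (coord k ∘L V)
      (fun a x => by rw [ContinuousLinearMap.comp_apply, hV]; rfl) Ω)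
  intro w
  have : E.starProjection w = w :=
    congrArg (fun S : Alg (vnGen (Set.range ρ)) => (S : K →L[ℂ] K) w) hone
  exact Submodule.starProjection_eq_self_iff.1 this

/-- A representation `ρ` of a *-algebra with a normal state of central support `1` on `ρ(𝒜)''` is
quasi-equivalent to the cyclic representation `π` of the restriction of the state to `𝒜`.  The
isomorphism identifies `ρ(B)''` with `π(B)''` for all self-adjoint subsets `B`. -/
theorem exists_quasiEquiv {Ω : L} (hΩ : DenseRange fun a => π a Ω)
    {M : VonNeumannAlgebra K} (hM : M = vnGen (Set.range ρ)) (σ : NormalState M)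
    (hσ : ∀ a (h : ρ a ∈ M), σ.toCLM ⟨ρ a, h⟩ = ⟪Ω, π a Ω⟫_ℂ) (hσ1 : σ.CentralSupportEqOne) :
    ∃ Φ : Alg M ≃⋆ₐ[ℂ] Alg (vnGen (Set.range π)),
      (∀ a (h : ρ a ∈ M), (Φ ⟨ρ a, h⟩ : L →L[ℂ] L) = π a) ∧
      (∀ b, ⟪Ω, (Φ b : L →L[ℂ] L) Ω⟫_ℂ = σ.toCLM b) ∧
      ∀ B : Set 𝒜, (∀ a ∈ B, star a ∈ B) → ∀ b : Alg M,
        (b : K →L[ℂ] K) ∈ vnGen (ρ '' B) ↔ (Φ b : L →L[ℂ] L) ∈ vnGen (π '' B) := by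
  subst hM
  have hρ : ∀ a, ρ a ∈ vnGen (Set.range ρ) := fun a => mem_vnGen ⟨a, rfl⟩
  obtain ⟨ζ, hζ⟩ := σ.exists_vector
  obtain ⟨V, hVΩ, hV, hVV⟩ := exists_isometric_intertwiner hΩ ((ampHom K).comp ρ) ζ fun a => by
    rw [← hσ a (hρ a), hζ]
    rfl
  have hd : DenseRange (interSum π ρ 1) :=
    denseRange_interSum hV σ (Ω := Ω) (by rw [hVΩ]; exact hζ) hσ1
  have happ : ∀ b : Alg (vnGen (Set.range ρ)), ∀ T, Intertwines π ρ T → ∀ x,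
      (b : K →L[ℂ] K) (T x) = T ((compressHom hV hVV b : L →L[ℂ] L) x) :=
    fun b T hT x => apply_intertwiner hV hVV b.2 hT x
  -- `π`-side operators are determined by their action on the ranges of the intertwiners
  have hdet : ∀ z z' : L →L[ℂ] L, (∀ T, Intertwines π ρ T → ∀ x, T (z x) = T (z' x)) → z = z' := by
    intro z z' h
    ext x
    rw [← hVV (z x), ← hVV (z' x)]
    congr 1
    ext k
    exact h (coord k ∘L V) (fun a x => by rw [ContinuousLinearMap.comp_apply, hV]; rfl) x
  have hinj : Function.Injective (compressHom hV hVV) := fun b c hbc =>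
    Subtype.ext (eq_of_intertwiners hd fun T hT x => by rw [happ b T hT, happ c T hT, hbc])
  have hsurj : Function.Surjective (compressHom hV hVV) := by
    rintro ⟨z, hz⟩
    obtain ⟨y, hy⟩ := exists_extend hd hz
    have hym : y ∈ vnGen (Set.range ρ) := by
      rw [← Set.image_univ]
      exact extend_mem hd (B := Set.univ) (fun _ _ => trivial) (by rw [Set.image_univ]; exact hz) hy
    exact ⟨⟨y, hym⟩, Subtype.ext (hdet _ _ fun T hT x => by
      rw [← happ ⟨y, hym⟩ T hT x]; exact hy T hT x)⟩
  refine ⟨StarAlgEquiv.ofBijective (compressHom hV hVV) ⟨hinj, hsurj⟩, fun a h => ?_, fun b => ?_,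
    fun B hB b => ⟨fun hb => ?_, fun hb => ?_⟩⟩
  · refine hdet _ _ fun T hT x => ?_
    rw [hT]
    exact (happ ⟨ρ a, h⟩ T hT x).symm
  · change ⟪Ω, compress V b Ω⟫_ℂ = _
    rw [compress_apply, ContinuousLinearMap.adjoint_inner_right, hVΩ, hζ, ampRep_apply]
  · exact compress_mem hV hVV hB hb
  · have := extend_mem hd hB hb (y := (b : K →L[ℂ] K)) fun T hT x => happ b T hT x
    exact this

end QuasiEquivalence

/-! ### The algebraic limit of an increasing net -/

section StarLimit

variable {I : Type*} [Preorder I] [IsDirectedOrder I] [Nonempty I] (G : I → Type*)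
  [∀ n, Ring (G n)] [∀ n, StarRing (G n)] [∀ n, Algebra ℂ (G n)]
  (f : ∀ m n : I, m ≤ n → G m →⋆ₐ[ℂ] G n) [DirectedSystem G (f · · ·)]

/-- The algebraic direct limit of a directed system of unital *-algebras. -/
def StarLimit : Type _ := DirectLimit G f

namespace StarLimit

instance : Ring (StarLimit G f) := inferInstanceAs (Ring (DirectLimit G f))

instance : Algebra ℂ (StarLimit G f) := inferInstanceAs (Algebra ℂ (DirectLimit G f))

instance : StarRing (StarLimit G f) where
  star := (star : DirectLimit G f → DirectLimit G f)
  star_involutive := star_star (R := DirectLimit G f)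
  star_mul := star_mul (R := DirectLimit G f)
  star_add := star_add (R := DirectLimit G f)

instance [∀ n, StarModule ℂ (G n)] : StarModule ℂ (StarLimit G f) where
  star_smul := star_smul (R := ℂ) (A := DirectLimit G f)

/-- The canonical *-morphism into the direct limit. -/
def of (n : I) : G n →⋆ₐ[ℂ] StarLimit G f where
  __ := DirectLimit.Algebra.of (R := ℂ) G f n
  map_star' _ := rfl

variable {G f}

theorem of_f {m n : I} (h : m ≤ n) (a : G m) : of G f n (f m n h a) = of G f m a :=
  DirectLimit.Algebra.of_f (R := ℂ) (f := f) h a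

theorem exists_of (x : StarLimit G f) : ∃ n a, x = of G f n a := DirectLimit.exists_eq_mk _ x

/-- The *-morphism out of the direct limit given by a compatible family of *-morphisms. -/
def lift {B : Type*} [Ring B] [StarRing B] [Algebra ℂ B] (g : ∀ n, G n →⋆ₐ[ℂ] B)
    (hg : ∀ m n (h : m ≤ n) a, g n (f m n h a) = g m a) : StarLimit G f →⋆ₐ[ℂ] B where
  __ := DirectLimit.Algebra.lift (R := ℂ) G f B (fun n => (g n).toAlgHom) hg
  map_star' x := by
    obtain ⟨n, a, rfl⟩ := exists_of x
    exact map_star (g n) a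

theorem lift_of {B : Type*} [Ring B] [StarRing B] [Algebra ℂ B] (g : ∀ n, G n →⋆ₐ[ℂ] B)
    (hg : ∀ m n (h : m ≤ n) a, g n (f m n h a) = g m a) (n : I) (a : G n) :
    lift g hg (of G f n a) = g n a := rfl

/-- The functional on the direct limit given by a compatible family of functionals. -/
def liftLinear (g : ∀ n, G n →ₗ[ℂ] ℂ) (hg : ∀ m n (h : m ≤ n) a, g n (f m n h a) = g m a) :
    StarLimit G f →ₗ[ℂ] ℂ :=
  DirectLimit.Module.lift ℂ I G f g hg

end StarLimit

end StarLimit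

/-! ### The limit of a consistent family of states -/

section Limit

variable {N : ℕ} {I : Type u} [Preorder I] [IsDirectedOrder I] [Nonempty I] {H : I → Type v}
  [∀ n, NormedAddCommGroup (H n)] [∀ n, InnerProductSpace ℂ (H n)] [∀ n, CompleteSpace (H n)]
  (D : IncreasingNet N I H)

instance : DirectedSystem (fun n => Alg (D.sys n).total) (fun _ _ h => D.inc h) where
  map_self _ a := D.inc_refl _ a
  map_map _ _ _ h h' a := D.inc_trans h h' a

/-- The algebraic direct limit of the `N`-partite algebras of the net, a unital *-algebra. -/
abbrev LimAlg : Type _ := StarLimit (fun n => Alg (D.sys n).total) (fun _ _ h => D.inc h)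

/-- The canonical *-morphism into the direct limit. -/
def toLim (n : I) : Alg (D.sys n).total →⋆ₐ[ℂ] LimAlg D :=
  StarLimit.of (fun n => Alg (D.sys n).total) (fun _ _ h => D.inc h) n

variable {D}

theorem toLim_inc {m n : I} (h : m ≤ n) (a : Alg (D.sys m).total) :
    toLim D n (D.inc h a) = toLim D m a :=
  StarLimit.of_f (f := fun _ _ h => D.inc h) h a

theorem exists_toLim (x : LimAlg D) : ∃ n a, x = toLim D n a := StarLimit.exists_of x

theorem exists_toLim_ge (m : I) (x : LimAlg D) : ∃ n, m ≤ n ∧ ∃ a, x = toLim D n a := by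
  obtain ⟨k, a, rfl⟩ := exists_toLim x
  obtain ⟨n, hm, hk⟩ := exists_ge_ge m k
  exact ⟨n, hm, D.inc hk a, (toLim_inc hk a).symm⟩

/-- A consistent family of states as a functional on the direct limit. -/
def limState (ω : (n : I) → NormalState (D.sys n).total)
    (hω : ∀ {m n : I} (h : m ≤ n) (a : Alg (D.sys m).total),
      (ω n).toCLM (D.inc h a) = (ω m).toCLM a) : LimAlg D →ₗ[ℂ] ℂ :=
  StarLimit.liftLinear (fun n => (ω n).toCLM.toLinearMap) fun _ _ h a => hω h a

variable (ω : (n : I) → NormalState (D.sys n).total)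
    (hω : ∀ {m n : I} (h : m ≤ n) (a : Alg (D.sys m).total),
      (ω n).toCLM (D.inc h a) = (ω m).toCLM a)

theorem limState_toLim (n : I) (a : Alg (D.sys n).total) :
    limState ω hω (toLim D n a) = (ω n).toCLM a := rfl

theorem limState_nonneg (x : LimAlg D) : 0 ≤ limState ω hω (star x * x) := by
  obtain ⟨n, a, rfl⟩ := exists_toLim x
  rw [← map_star, ← map_mul]
  exact (ω n).nonneg' a

/-- Left multiplications by elements of the direct limit are bounded, as they are at each stage. -/
theorem limState_bounded (x : LimAlg D) : ∃ C : ℝ, ∀ y,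
    (limState ω hω (star (x * y) * (x * y))).re ≤ C * (limState ω hω (star y * y)).re := by
  obtain ⟨m, a, rfl⟩ := exists_toLim x
  refine ⟨‖a‖ ^ 2, fun y => ?_⟩
  obtain ⟨n, h, b, rfl⟩ := exists_toLim_ge m y
  rw [← toLim_inc h a, ← map_mul, ← map_star, ← map_mul, ← map_star, ← map_mul, limState_toLim,
    limState_toLim]
  have h1 := re_map_star_mul_mul_le (f := (ω n).toCLM.toLinearMap) (ω n).nonneg' (D.inc h a) b
  refine h1.trans (mul_le_mul_of_nonneg_right ?_ (Complex.nonneg_iff.1 ((ω n).nonneg' b)).1)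
  have : ‖D.inc h a‖ ≤ ‖a‖ := NonUnitalStarAlgHom.norm_apply_le (D.inc h) a
  gcongr

/-- A cyclic representation of the direct limit in which the cyclic vector implements the family of
states. -/
structure IsLimGNS (ω : (n : I) → NormalState (D.sys n).total) {K : Type*} [NormedAddCommGroup K]
    [InnerProductSpace ℂ K] [CompleteSpace K] (π : LimAlg D →⋆ₐ[ℂ] (K →L[ℂ] K)) (Ω : K) :
    Prop where
  dense : DenseRange fun x => π x Ω
  state : ∀ n a, ⟪Ω, π (toLim D n a) Ω⟫_ℂ = (ω n).toCLM a

/-- The GNS representation of the state on the algebraic direct limit. -/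
theorem exists_isLimGNS (ω : (n : I) → NormalState (D.sys n).total)
    (hω : ∀ {m n : I} (h : m ≤ n) (a : Alg (D.sys m).total),
      (ω n).toCLM (D.inc h a) = (ω m).toCLM a) :
    ∃ (K : Type (max u v)) (_ : NormedAddCommGroup K) (_ : InnerProductSpace ℂ K)
      (_ : CompleteSpace K) (π : LimAlg D →⋆ₐ[ℂ] (K →L[ℂ] K)) (Ω : K), IsLimGNS ω π Ω := by
  obtain ⟨K, i1, i2, i3, π, Ω, h1, h2⟩ := exists_gns (limState_nonneg ω hω) (limState_bounded ω hω)
  exact ⟨K, i1, i2, i3, π, Ω, h1, fun n a => h2 _⟩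

end Limit

/-! ### The limit system on the GNS space -/

section LimitSystem

theorem vnGen_image_commute {𝒜 : Type*} [Ring 𝒜] [StarRing 𝒜] [Algebra ℂ 𝒜]
    {K : Type*} [NormedAddCommGroup K] [InnerProductSpace ℂ K] [CompleteSpace K]
    {π : 𝒜 →⋆ₐ[ℂ] (K →L[ℂ] K)} {B C : Set 𝒜} (hB : ∀ a ∈ B, star a ∈ B) (hC : ∀ a ∈ C, star a ∈ C)
    (h : ∀ b ∈ B, ∀ c ∈ C, b * c = c * b) {S T : K →L[ℂ] K} (hS : S ∈ vnGen (π '' B))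
    (hT : T ∈ vnGen (π '' C)) : S * T = T * S := by
  refine (mem_vnGen_image_iff hC).1 hT S fun c hc => ?_
  refine (mem_vnGen_image_iff hB).1 hS (π c) fun b hb => ?_
  rw [← map_mul, h b hb c hc, map_mul]

variable {N : ℕ} {I : Type u} [Preorder I] [IsDirectedOrder I] [Nonempty I] {H : I → Type v}
  [∀ n, NormedAddCommGroup (H n)] [∀ n, InnerProductSpace ℂ (H n)] [∀ n, CompleteSpace (H n)]
  (D : IncreasingNet N I H)

/-- The elements of the direct limit which belong to party `x`. -/
def locSet (x : Fin N) : Set (LimAlg D) :=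
  ⋃ n, toLim D n '' {a | (a : H n →L[ℂ] H n) ∈ (D.sys n).loc x}

variable {D}

theorem toLim_mem_locSet {x : Fin N} {n : I} {a : Alg (D.sys n).total}
    (ha : (a : H n →L[ℂ] H n) ∈ (D.sys n).loc x) : toLim D n a ∈ locSet D x :=
  Set.mem_iUnion.2 ⟨n, Set.mem_image_of_mem _ ha⟩

theorem star_mem_locSet (x : Fin N) : ∀ a ∈ locSet D x, star a ∈ locSet D x := by
  intro a ha
  obtain ⟨n, a, han, rfl⟩ := Set.mem_iUnion.1 ha
  rw [← map_star]
  exact toLim_mem_locSet (star_mem han)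

theorem locSet_commute {x y : Fin N} (hxy : x ≠ y) :
    ∀ a ∈ locSet D x, ∀ b ∈ locSet D y, a * b = b * a := by
  intro a ha b hb
  obtain ⟨m, a, ham, rfl⟩ := Set.mem_iUnion.1 ha
  obtain ⟨n, b, hbn, rfl⟩ := Set.mem_iUnion.1 hb
  obtain ⟨k, hm, hn⟩ := exists_ge_ge m n
  rw [← toLim_inc hm, ← toLim_inc hn, ← map_mul, ← map_mul]
  congr 1
  exact Subtype.ext ((D.sys k).comm x y hxy _ (D.inc_loc hm x a ham) _ (D.inc_loc hn y b hbn))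

variable {K : Type*} [NormedAddCommGroup K] [InnerProductSpace ℂ K] [CompleteSpace K]

/-- The `N`-partite system on the space of a representation of the direct limit: the algebra of a
party is generated by the elements of the direct limit which belong to it. -/
def limSystem (π : LimAlg D →⋆ₐ[ℂ] (K →L[ℂ] K)) : PartiteSystem N K where
  loc x := vnGen (π '' locSet D x)
  comm _ _ hxy _ ha _ hb :=
    vnGen_image_commute (star_mem_locSet _) (star_mem_locSet _) (locSet_commute hxy) ha hb

variable {ω : (n : I) → NormalState (D.sys n).total} {π : LimAlg D →⋆ₐ[ℂ] (K →L[ℂ] K)} {Ω : K}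

/-- The amplified representation of the algebra of one stage has an intertwiner to the limit
representation with the cyclic vector in its range. -/
theorem IsLimGNS.exists_stage_intertwiner (hπ : IsLimGNS ω π Ω) (n : I) :
    ∃ (W : L2 (H n) →L[ℂ] K) (ζ : L2 (H n)), W ζ = Ω ∧
      ∀ (a : Alg (D.sys n).total) y, W (amp (a : H n →L[ℂ] H n) y) = π (toLim D n a) (W y) := by
  obtain ⟨ζ, hζ⟩ := (ω n).exists_vector
  obtain ⟨G, _, _, _, ρ, Ψ, hΨ, hρ⟩ := exists_gns (f := (ω n).toCLM.toLinearMap) (ω n).nonneg'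
    fun a => ⟨‖a‖ ^ 2, re_map_star_mul_mul_le (ω n).nonneg' a⟩
  obtain ⟨V, hVΨ, hV, hVV⟩ := exists_isometric_intertwiner hΨ (ampRep (D.sys n).total) ζ
    fun a => by rw [hρ, ← hζ]; rfl
  obtain ⟨J, hJΨ, hJ, -⟩ := exists_isometric_intertwiner hΨ (π.comp (toLim D n)) Ω
    fun a => by rw [hρ]; exact hπ.state n a
  refine ⟨J ∘L V.adjoint, ζ, ?_, fun a y => ?_⟩
  · rw [ContinuousLinearMap.comp_apply, ← hVΨ, hVV, hJΨ]
  · rw [ContinuousLinearMap.comp_apply, ← ampRep_apply, adjoint_intertwines hV, hJ]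
    rfl

/-- The algebras of the parties in the limit generate the images of the `N`-partite algebras of all
stages. -/
theorem IsLimGNS.mem_total (hπ : IsLimGNS ω π Ω) (x : LimAlg D) : π x ∈ (limSystem π).total := by
  refine mem_vnGen_iff.2 fun T hT _ => ?_
  have hT' : ∀ n i (a : Alg (D.sys n).total), (a : H n →L[ℂ] H n) ∈ (D.sys n).loc i →
      π (toLim D n a) * T = T * π (toLim D n a) := fun n i a ha =>
    hT _ (Set.mem_iUnion.2 ⟨i, mem_vnGen (Set.mem_image_of_mem _ (toLim_mem_locSet ha))⟩)
  -- compare matrix coefficients on the dense set of vectors from a common stage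
  ext1 v
  refine ext_inner_left ℂ fun w => ?_
  induction v, w using hπ.dense.induction_on₂ with
  | hp => apply isClosed_eq <;> fun_prop
  | h u u' =>
    obtain ⟨n₀, a₀, rfl⟩ := exists_toLim x
    obtain ⟨n₁, h₁, b₁, rfl⟩ := exists_toLim_ge n₀ u
    obtain ⟨n, h₂, c, rfl⟩ := exists_toLim_ge n₁ u'
    rw [← toLim_inc (h₁.trans h₂) a₀, ← toLim_inc h₂ b₁]
    generalize D.inc (h₁.trans h₂) a₀ = a
    generalize D.inc h₂ b₁ = b
    obtain ⟨W, ζ, hWζ, hW⟩ := hπ.exists_stage_intertwiner n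
    have hWa : ∀ (a : Alg (D.sys n).total) y,
        W.adjoint (π (toLim D n a) y) = amp (a : H n →L[ℂ] H n) (W.adjoint y) :=
      adjoint_intertwines (π := ampRep (D.sys n).total) (ρ := π.comp (toLim D n)) hW
    have hcomm : (W.adjoint ∘L T ∘L W) * amp (a : H n →L[ℂ] H n) =
        amp (a : H n →L[ℂ] H n) * (W.adjoint ∘L T ∘L W) := by
      have aux : ∀ y ∈ ⋃ i, ((D.sys n).loc i : Set (H n →L[ℂ] H n)),
          (W.adjoint ∘L T ∘L W) * amp y = amp y * (W.adjoint ∘L T ∘L W) := by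
        intro y hy
        obtain ⟨i, hi⟩ := Set.mem_iUnion.1 hy
        let y' : Alg (D.sys n).total := ⟨y, subset_vnGen _ hy⟩
        ext1 ξ
        change W.adjoint (T (W (amp (y' : H n →L[ℂ] H n) ξ))) =
          amp (y' : H n →L[ℂ] H n) (W.adjoint (T (W ξ)))
        rw [hW, ← mul_apply_eq_comp T, ← hT' n i y' hi, mul_apply_eq_comp, hWa]
      refine amp_commute_of_mem_vnGen a.2 aux fun y hy => aux _ ?_
      obtain ⟨i, hi⟩ := Set.mem_iUnion.1 hy
      exact Set.mem_iUnion.2 ⟨i, star_mem hi⟩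
    have key := congrArg (fun R : L2 (H n) →L[ℂ] L2 (H n) =>
      ⟪amp (c : H n →L[ℂ] H n) ζ, R (amp (b : H n →L[ℂ] H n) ζ)⟫_ℂ) hcomm
    simp only [mul_apply_eq_comp, ContinuousLinearMap.comp_apply] at key
    rw [← hWa, ContinuousLinearMap.adjoint_inner_right, ContinuousLinearMap.adjoint_inner_right,
      hW, hW, hW, hWζ] at key
    simpa only [mul_apply_eq_comp] using key

/-- All vectors are normal, since those of the form `π(b) Ω` with `b` from a stage `m` are: their
functionals `a ↦ ω⁽ᵐ⁾(b⋆ a b)` are normal because the inclusions are. -/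
theorem IsLimGNS.isNormalVector (hπ : IsLimGNS ω π Ω) (n : I) (x : K) :
    IsNormalVector (π.comp (toLim D n)) x := by
  let e : LimAlg D →ₗ[ℂ] K := (ContinuousLinearMap.apply ℂ K Ω).toLinearMap ∘ₗ π.toLinearMap
  refine isNormalVector_of_dense (LinearMap.range e).toAddSubgroup ?_ ?_ x
  · intro v
    exact hπ.dense v
  · rintro _ ⟨y, rfl⟩
    obtain ⟨m, h, b, rfl⟩ := exists_toLim_ge n y
    change IsNormalVector _ (π (toLim D m b) Ω)
    obtain ⟨W, ζ, hWζ, hW⟩ := hπ.exists_stage_intertwiner m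
    obtain ⟨θ, hθ⟩ := (ω m).exists_vector
    let f : Alg (D.sys n).total →ₗ[ℂ] ℂ := (innerSL ℂ (π (toLim D m b) Ω)).toLinearMap ∘ₗ
      (ContinuousLinearMap.apply ℂ K (π (toLim D m b) Ω)).toLinearMap ∘ₗ
        (π.comp (toLim D n)).toLinearMap
    refine exists_vector_of_continuous (f := f)
      (fun a => inner_apply_star_mul_self_nonneg (π.comp (toLim D n)) _ a) ?_
    have hf : ∀ a, f a =
        ⟪ampRep (D.sys m).total b θ, ampRep (D.sys m).total (D.inc h a)
          (ampRep (D.sys m).total b θ)⟫_ℂ := by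
      intro a
      change ⟪π (toLim D m b) Ω, π (toLim D n a) (π (toLim D m b) Ω)⟫_ℂ = _
      rw [← toLim_inc h, ← star_star (π (toLim D m b)), inner_star_apply,
        ← star_star (ampRep (D.sys m).total b), inner_star_apply, star_star, star_star,
        ← map_star, ← map_star, ← map_star, ← mul_apply_eq_comp, ← mul_apply_eq_comp,
        ← mul_apply_eq_comp, ← mul_apply_eq_comp, ← map_mul, ← map_mul, ← map_mul, ← map_mul,
        ← map_mul, ← map_mul, hπ.state, hθ]
    have := continuous_comp_of_isNormalHom (D.inc_normal h) (ampRep (D.sys m).total b θ)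
      (ampRep (D.sys m).total b θ)
    rwa [show (f : Alg (D.sys n).total → ℂ) = _ from funext hf]

/-- The *-morphisms from the stages to the limit system. -/
def limHom (hπ : IsLimGNS ω π Ω) (n : I) :
    Alg (D.sys n).total →⋆ₐ[ℂ] Alg (limSystem π).total :=
  (π.comp (toLim D n)).codRestrict (limSystem π).total.toStarSubalgebra fun _ => hπ.mem_total _

theorem coe_limHom (hπ : IsLimGNS ω π Ω) (n : I) (a : Alg (D.sys n).total) :
    (limHom hπ n a : K →L[ℂ] K) = π (toLim D n a) := rfl

theorem limHom_isNormal (hπ : IsLimGNS ω π Ω) (n : I) : IsNormalHom (limHom hπ n) :=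
  isNormalHom_of_isNormalVector _ fun x => hπ.isNormalVector n x

theorem IsLimGNS.inner_self (hπ : IsLimGNS ω π Ω) : ⟪Ω, Ω⟫_ℂ = 1 := by
  have := hπ.state (Classical.arbitrary I) 1
  rwa [map_one, map_one, one_apply_eq_self, (ω _).map_one'] at this

/-- The vector state of the cyclic vector on the limit system. -/
def limNormalState (hπ : IsLimGNS ω π Ω) : NormalState (limSystem π).total where
  toCLM := (innerSL ℂ Ω) ∘L (ContinuousLinearMap.apply ℂ K Ω) ∘L
    (limSystem π).total.toStarSubalgebra.toSubalgebra.toSubmodule.subtypeL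
  nonneg' a :=
    inner_apply_star_mul_self_nonneg (limSystem π).total.toStarSubalgebra.subtype Ω a
  map_one' := hπ.inner_self
  normal' := by
    have := continuous_ultraweak_inner_amp (limSystem π).total (slot 0 Ω) (slot 0 Ω)
    convert this using 2 with a
    rw [amp_slot]
    simp only [lp.singleContinuousLinearMap_apply, lp.inner_single_left, lp.single_apply_self]
    rfl

theorem limNormalState_apply (hπ : IsLimGNS ω π Ω) (a : Alg (limSystem π).total) :
    (limNormalState hπ).toCLM a = ⟪Ω, (a : K →L[ℂ] K) Ω⟫_ℂ := rfl

/-- A central projection which fixes the cyclic vector is `1`. -/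
theorem limNormalState_centralSupport (hπ : IsLimGNS ω π Ω) :
    (limNormalState hπ).CentralSupportEqOne := by
  intro p hp hc h1
  rw [limNormalState_apply] at h1
  have hpp : (p : K →L[ℂ] K) * p = p := congrArg Subtype.val hp.1
  have hps : star (p : K →L[ℂ] K) = p := congrArg Subtype.val hp.2
  have hpΩ : (p : K →L[ℂ] K) Ω = Ω := by
    rw [← sub_eq_zero, ← inner_self_eq_zero (𝕜 := ℂ), inner_sub_left, inner_sub_right,
      inner_sub_right, h1, hπ.inner_self]
    have h2 : ⟪(p : K →L[ℂ] K) Ω, (p : K →L[ℂ] K) Ω⟫_ℂ = 1 := by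
      conv_lhs => rw [← hps, inner_star_apply, hps, ← mul_apply_eq_comp, hpp]
      exact h1
    have h3 : ⟪(p : K →L[ℂ] K) Ω, Ω⟫_ℂ = 1 := by
      conv_lhs => rw [← hps, inner_star_apply]
      exact h1
    rw [h2, h3]
    norm_num
  refine Subtype.ext ?_
  ext v
  induction v using hπ.dense.induction_on with
  | hp => exact isClosed_eq (p : K →L[ℂ] K).continuous (ContinuousLinearMap.continuous _)
  | ih x =>
    have := congrArg (fun S : Alg (limSystem π).total => (S : K →L[ℂ] K) Ω)
      (hc ⟨π x, hπ.mem_total x⟩)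
    simp only [MulMemClass.coe_mul, mul_apply_eq_comp] at this
    rw [hpΩ] at this
    simpa using this

theorem limSystem_total_eq (hπ : IsLimGNS ω π Ω) : (limSystem π).total =
    vnGen (⋃ n, Set.range fun a : Alg (D.sys n).total => (limHom hπ n a : K →L[ℂ] K)) := by
  refine VonNeumannAlgebra.ext fun S => ⟨fun h => ?_, fun h => ?_⟩
  · refine vnGen_le (fun T hT => ?_) h
    obtain ⟨i, hi⟩ := Set.mem_iUnion.1 hT
    refine vnGen_le (fun R hR => mem_vnGen ?_) hi
    obtain ⟨_, hx, rfl⟩ := hR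
    obtain ⟨n, a, -, rfl⟩ := Set.mem_iUnion.1 hx
    exact Set.mem_iUnion.2 ⟨n, a, rfl⟩
  · refine vnGen_le (fun T hT => ?_) h
    obtain ⟨n, a, rfl⟩ := Set.mem_iUnion.1 hT
    exact hπ.mem_total _

theorem limSystem_isGeneratedBy (hπ : IsLimGNS ω π Ω) :
    IsGeneratedBy D (limSystem π) (limHom hπ) := by
  intro x
  change vnGen _ = _
  congr 1
  simp only [locSet, Set.image_iUnion, Set.image_image]
  rfl

/-- The *-morphism from a stage whose `N`-partite algebra is a factor is injective: an element of
its kernel vanishes on a nonzero subspace invariant under the factor and its commutant. -/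
theorem limHom_injective (hπ : IsLimGNS ω π Ω) (n : I) (hf : IsFactor (D.sys n).total) :
    Function.Injective (limHom hπ n) := by
  rw [injective_iff_map_eq_zero]
  intro a ha
  obtain ⟨ζ, hζ⟩ := (ω n).exists_vector
  have h0 : ∀ (b : Alg (D.sys n).total) k,
      (a : H n →L[ℂ] H n) ((b : H n →L[ℂ] H n) (ζ k)) = 0 := by
    intro b k
    have h1 : ‖ampRep (D.sys n).total (a * b) ζ‖ ^ 2 = 0 := by
      rw [norm_sq_apply_eq, ← hζ, ← hπ.state, ← StarAlgHom.comp_apply, ← norm_sq_apply_eq, map_mul,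
        StarAlgHom.comp_apply, ← coe_limHom hπ, ha]
      simp
    have h2 : ampRep (D.sys n).total (a * b) ζ = 0 := by simpa using h1
    have h3 := congrArg (fun ξ : L2 (H n) => ξ k) h2
    simpa [ampRep_apply] using h3
  let E : Submodule ℂ (H n) := ⨅ b : Alg (D.sys n).total,
    LinearMap.ker ((a : H n →L[ℂ] H n) ∘L (b : H n →L[ℂ] H n)).toLinearMap
  have hE : ∀ w, w ∈ E ↔
      ∀ b : Alg (D.sys n).total, (a : H n →L[ℂ] H n) ((b : H n →L[ℂ] H n) w) = 0 := by
    simp [E]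
  have hEc : IsClosed (E : Set (H n)) := by
    simp only [E, Submodule.coe_iInf]
    exact isClosed_iInter fun b => ContinuousLinearMap.isClosed_ker _
  have : CompleteSpace E := hEc.completeSpace_coe
  have hinv : ∀ s ∈ (D.sys n).total, ∀ w ∈ E, s w ∈ E := fun s hs w hw =>
    (hE _).2 fun b => (hE w).1 hw (b * (⟨s, hs⟩ : Alg (D.sys n).total))
  have hinv' : ∀ s ∈ (D.sys n).total.commutant, ∀ w ∈ E, s w ∈ E := fun s hs w hw =>
    (hE _).2 fun b => by
      rw [VonNeumannAlgebra.mem_commutant_iff] at hs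
      rw [← mul_apply_eq_comp (b : H n →L[ℂ] H n), hs _ b.2, mul_apply_eq_comp,
        ← mul_apply_eq_comp (a : H n →L[ℂ] H n), hs _ a.2, mul_apply_eq_comp, (hE w).1 hw, map_zero]
  obtain ⟨c, hc⟩ := hf E.starProjection
    (by
      rw [← (D.sys n).total.commutant_commutant, VonNeumannAlgebra.mem_commutant_iff]
      exact fun s hs => mul_starProjection_comm (hinv' s hs) (hinv' _ (star_mem hs)))
    (by
      rw [VonNeumannAlgebra.mem_commutant_iff]
      exact fun s hs => mul_starProjection_comm (hinv s hs) (hinv _ (star_mem hs)))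
  have hζE : ∀ k, ζ k ∈ E := fun k => (hE _).2 fun b => h0 b k
  obtain ⟨k, hk⟩ : ∃ k, ζ k ≠ 0 := by
    by_contra! h
    have h1 := hζ 1
    rw [show ζ = 0 from lp.ext (funext h), (ω n).map_one'] at h1
    simp at h1
  have hc1 : c = 1 := by
    have h1 : c • ζ k = ζ k := by
      conv_rhs => rw [← Submodule.starProjection_eq_self_iff.2 (hζE k), hc]
      rfl
    exact (smul_left_injective ℂ hk) (h1.trans (one_smul ℂ _).symm)
  refine Subtype.ext ?_
  ext w
  have hw : w ∈ E := by
    rw [← Submodule.starProjection_eq_self_iff, hc, hc1, one_smul]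
    rfl
  simpa using (hE w).1 hw 1

theorem separableSpace_L2 {E : Type*} [NormedAddCommGroup E] [InnerProductSpace ℂ E]
    [TopologicalSpace.SeparableSpace E] : TopologicalSpace.SeparableSpace (L2 E) := by
  have h1 : TopologicalSpace.IsSeparable (⋃ k, Set.range (slot (H := E) k)) :=
    TopologicalSpace.IsSeparable.iUnion fun k => TopologicalSpace.isSeparable_range (slot k).continuous
  refine TopologicalSpace.isSeparable_univ_iff.1 ((h1.span (R := ℂ)).closure.mono fun ξ _ => ?_)
  refine mem_closure_of_tendsto (lp.hasSum_single (by simp) ξ) (Filter.Eventually.of_forall fun s => ?_)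
  exact Submodule.sum_mem _ fun k _ => Submodule.subset_span (Set.mem_iUnion.2 ⟨k, ξ k, rfl⟩)

/-- The space of the limit is the closure of the union of the ranges of intertwiners from countably
many stages. -/
theorem IsLimGNS.separableSpace (hπ : IsLimGNS ω π Ω)
    (hI : (Filter.atTop : Filter I).IsCountablyGenerated)
    (hH : ∀ n, TopologicalSpace.SeparableSpace (H n)) : TopologicalSpace.SeparableSpace K := by
  obtain ⟨x, hx⟩ := Filter.exists_seq_tendsto (Filter.atTop : Filter I)
  choose W ζ hWζ hW using fun n => hπ.exists_stage_intertwiner n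
  have h1 : TopologicalSpace.IsSeparable (⋃ k, Set.range (W (x k))) :=
    TopologicalSpace.IsSeparable.iUnion fun k => by
      have := separableSpace_L2 (E := H (x k))
      exact TopologicalSpace.isSeparable_range (W (x k)).continuous
  refine TopologicalSpace.isSeparable_univ_iff.1 (h1.closure.mono ?_)
  rw [← hπ.dense.closure_range]
  refine closure_mono ?_
  rintro _ ⟨y, rfl⟩
  obtain ⟨n, a, rfl⟩ := exists_toLim y
  obtain ⟨k, hk⟩ := (hx.eventually (Filter.eventually_ge_atTop n)).exists
  refine Set.mem_iUnion.2 ⟨k, amp (D.inc hk a : H (x k) →L[ℂ] H (x k)) (ζ (x k)), ?_⟩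
  rw [hW, hWζ, toLim_inc]

end LimitSystem

/-! ### Strong* density -/

section StrongDensity

/-- A vector belongs to the closure of a real subspace of a complex Hilbert space if it is
annihilated by the real parts of all functionals whose real parts annihilate the subspace. -/
theorem mem_closure_of_re_inner_eq_zero {𝓗 : Type*} [NormedAddCommGroup 𝓗] [InnerProductSpace ℂ 𝓗]
    [CompleteSpace 𝓗] (X : AddSubgroup 𝓗) (hX : ∀ (r : ℝ), ∀ x ∈ X, (r : ℂ) • x ∈ X) {w : 𝓗}
    (h : ∀ v, (∀ x ∈ X, (⟪v, x⟫_ℂ).re = 0) → (⟪v, w⟫_ℂ).re = 0) : w ∈ closure (X : Set 𝓗) := by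
  let _ := InnerProductSpace.rclikeToReal ℂ 𝓗
  let Y : Submodule ℝ 𝓗 := { X with smul_mem' := fun r x hx => hX r x hx }
  have hY : w ∈ Yᗮᗮ := by
    rw [Submodule.mem_orthogonal]
    intro v hv
    rw [Submodule.mem_orthogonal'] at hv
    exact h v hv
  rw [Submodule.orthogonal_orthogonal_eq_closure] at hY
  exact hY

variable {𝒜 : Type*} [Ring 𝒜] [StarRing 𝒜] [Algebra ℂ 𝒜]
variable {K : Type*} [NormedAddCommGroup K] [InnerProductSpace ℂ K] [CompleteSpace K]
  {π : 𝒜 →⋆ₐ[ℂ] (K →L[ℂ] K)}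

/-- An ultraweakly continuous functional which vanishes on `π(𝒜)` vanishes on `π(𝒜)''`. -/
theorem inner_amp_eq_zero {P Q : L2 K} (h : ∀ z, ⟪P, amp (π z) Q⟫_ℂ = 0) {b : K →L[ℂ] K}
    (hb : b ∈ vnGen (Set.range π)) : ⟪P, amp b Q⟫_ℂ = 0 := by
  let e : 𝒜 →ₗ[ℂ] L2 K := (ContinuousLinearMap.apply ℂ (L2 K) Q).toLinearMap ∘ₗ
    ((ampHom K).comp π).toLinearMap
  let E : Submodule ℂ (L2 K) := (LinearMap.range e).topologicalClosure
  have hinv : ∀ z, ∀ w ∈ E, amp (π z) w ∈ E := by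
    intro z w hw
    have h1 : LinearMap.range e ≤ E.comap (amp (π z)).toLinearMap := by
      rintro _ ⟨u, rfl⟩
      refine Submodule.le_topologicalClosure _ ⟨z * u, ?_⟩
      change amp (π (z * u)) Q = amp (π z) (amp (π u) Q)
      rw [map_mul, amp_mul, mul_apply_eq_comp]
    have h2 : IsClosed (E.comap (amp (π z)).toLinearMap : Set (L2 K)) :=
      (Submodule.isClosed_topologicalClosure _).preimage (amp (π z)).continuous
    exact Submodule.topologicalClosure_minimal _ h1 h2 hw
  have hcomm : E.starProjection * amp b = amp b * E.starProjection := by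
    have aux : ∀ z, E.starProjection * amp (π z) = amp (π z) * E.starProjection := fun z =>
      (mul_starProjection_comm (hinv z) (by rw [← amp_star, ← map_star]; exact hinv _)).symm
    refine amp_commute_of_mem_vnGen hb (Set.forall_mem_range.2 aux)
      (Set.forall_mem_range.2 fun z => ?_)
    rw [← map_star]
    exact aux _
  have hQ : Q ∈ E := Submodule.le_topologicalClosure _ ⟨1, by simp [e]⟩
  have hbQ : amp b Q ∈ E := by
    have := congrArg (fun S : L2 K →L[ℂ] L2 K => S Q) hcomm
    simp only [mul_apply_eq_comp, Submodule.starProjection_eq_self_iff.2 hQ] at this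
    exact Submodule.starProjection_eq_self_iff.1 this
  have hle : E ≤ LinearMap.ker (innerSL ℂ P).toLinearMap :=
    Submodule.topologicalClosure_minimal _ (by rintro _ ⟨z, rfl⟩; exact h z)
      (ContinuousLinearMap.isClosed_ker (innerSL ℂ P))
  exact hle hbQ

/-- Elements of `π(𝒜)''` and their adjoints are simultaneously approximated by elements of `π(𝒜)`
on each vector of the amplification.  As the adjoint is only conjugate linear, the separation
argument is carried out in the real space of pairs `(b Q, b⋆ Q)`. -/
theorem exists_strongStar_approx {y : K →L[ℂ] K} (hy : y ∈ vnGen (Set.range π)) (Q : L2 K) {δ : ℝ}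
    (hδ : 0 < δ) : ∃ z : 𝒜, ‖amp (π z - y) Q‖ < δ ∧ ‖amp (star (π z) - star y) Q‖ < δ := by
  let e : (K →L[ℂ] K) →+ L2 (L2 K) :=
    { toFun := fun b => slot 0 (amp b Q) + slot 1 (amp (star b) Q)
      map_zero' := by simp
      map_add' := fun b c => by
        simp only [star_add, amp_add, add_apply, map_add]; abel }
  let X : AddSubgroup (L2 (L2 K)) := (e.comp (π : 𝒜 →+ (K →L[ℂ] K))).range
  have hw : e y ∈ closure (X : Set (L2 (L2 K))) := by
    refine mem_closure_of_re_inner_eq_zero X ?_ fun v hv => ?_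
    · rintro r _ ⟨z, rfl⟩
      refine ⟨(r : ℂ) • z, ?_⟩
      change slot 0 (amp (π ((r : ℂ) • z)) Q) + slot 1 (amp (star (π ((r : ℂ) • z))) Q) =
        (r : ℂ) • (slot 0 (amp (π z) Q) + slot 1 (amp (star (π z)) Q))
      rw [map_smul, star_smul, Complex.star_def, Complex.conj_ofReal, amp_smul, amp_smul,
        smul_apply, smul_apply, map_smul, map_smul, smul_add]
    · -- the real functional is the real part of a complex linear functional of `b`
      have hg : ∀ b, (⟪v, e b⟫_ℂ).re = (⟪flatten (slot 0 (v 0) + slot 1 Q),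
          amp b (flatten (slot 0 Q + slot 1 (v 1)))⟫_ℂ).re := by
        intro b
        have h1 : ⟪v, e b⟫_ℂ = ⟪v 0, amp b Q⟫_ℂ + ⟪v 1, amp (star b) Q⟫_ℂ := by
          simp [e, lp.inner_single_right]
        have h2 : ⟪flatten (slot 0 (v 0) + slot 1 Q), amp b (flatten (slot 0 Q + slot 1 (v 1)))⟫_ℂ =
            ⟪v 0, amp b Q⟫_ℂ + ⟪Q, amp b (v 1)⟫_ℂ := by
          rw [inner_flatten, map_add, amp_slot, amp_slot]
          simp [lp.inner_single_left]
        have h3 : (⟪v 1, amp (star b) Q⟫_ℂ).re = (⟪Q, amp b (v 1)⟫_ℂ).re := by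
          rw [amp_star, ← inner_conj_symm, Complex.conj_re, inner_star_apply]
        rw [h1, h2, Complex.add_re, Complex.add_re, h3]
      rw [hg, inner_amp_eq_zero (π := π) (fun z => ?_) hy, Complex.zero_re]
      have h1 := hv _ ⟨z, rfl⟩
      have h2 := hv _ ⟨Complex.I • z, rfl⟩
      change (⟪v, e (π z)⟫_ℂ).re = 0 at h1
      change (⟪v, e (π (Complex.I • z))⟫_ℂ).re = 0 at h2
      rw [hg] at h1 h2
      rw [map_smul, amp_smul, smul_apply, inner_smul_right, Complex.I_mul_re,
        neg_eq_zero] at h2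
      exact Complex.ext h1 h2
  obtain ⟨_, ⟨z, rfl⟩, hz⟩ := Metric.mem_closure_iff.1 hw δ hδ
  refine ⟨z, ?_, ?_⟩
  all_goals
    rw [dist_eq_norm, norm_sub_rev] at hz
    refine lt_of_le_of_lt ?_ hz
    change _ ≤ ‖e (π z) - e y‖
    rw [← map_sub]
  · refine le_of_eq_of_le (congrArg norm ?_) (lp.norm_apply_le_norm two_ne_zero (e (π z - y)) 0)
    simp [e]
  · refine le_of_eq_of_le (congrArg norm ?_) (lp.norm_apply_le_norm two_ne_zero (e (π z - y)) 1)
    simp [e]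

end StrongDensity

/-! ### A Kaplansky-type transform -/

section Kaplansky

variable {B : Type*} [CStarAlgebra B]

/-- The function `t ↦ 2t / (1 + t²)`, which maps `ℝ` onto `[-1, 1]`. -/
def bend (t : ℝ) : ℝ := 2 * t / (1 + t ^ 2)

theorem continuous_bend : Continuous bend :=
  (by fun_prop : Continuous fun t : ℝ => 2 * t).div (by fun_prop) fun t => by positivity

theorem abs_bend_le (t : ℝ) : |bend t| ≤ 1 := by
  rw [bend, abs_div, abs_of_pos (by positivity : (0 : ℝ) < 1 + t ^ 2), div_le_one (by positivity),
    abs_le]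
  constructor <;> nlinarith [sq_nonneg (t - 1), sq_nonneg (t + 1)]

/-- The inverse of `bend` on `[-1, 1]`, with values in `[-1, 1]`, is `t / (1 + √(1 - t²))`. -/
theorem bend_surj {t : ℝ} (ht : |t| ≤ 1) : bend (t / (1 + √(1 - t ^ 2))) = t := by
  have h1 : 0 ≤ 1 - t ^ 2 := by
    have := (sq_le_one_iff_abs_le_one t).2 ht
    linarith
  have hs := Real.sq_sqrt h1
  have hs0 := Real.sqrt_nonneg (1 - t ^ 2)
  generalize √(1 - t ^ 2) = s at hs hs0
  have hne : 1 + s ≠ 0 := by positivity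
  have hne' : (1 + s) ^ 2 + t ^ 2 ≠ 0 := by positivity
  rw [bend]
  field_simp
  linear_combination (-t) * hs

theorem norm_cfc_bend_le (a : B) : ‖cfc bend a‖ ≤ 1 :=
  norm_cfc_le zero_le_one fun t _ => abs_bend_le t

/-- The resolvent `(1 + a²)⁻¹`. -/
def resolv (a : B) : B := cfc (fun t : ℝ => (1 + t ^ 2)⁻¹) a

theorem norm_resolv_le (a : B) : ‖resolv a‖ ≤ 1 :=
  norm_cfc_le zero_le_one fun t _ => by
    rw [Real.norm_eq_abs, abs_of_pos (by positivity)]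
    exact inv_le_one_of_one_le₀ (by nlinarith [sq_nonneg t])

theorem continuous_resolv : Continuous fun t : ℝ => (1 + t ^ 2)⁻¹ :=
  (by fun_prop : Continuous fun t : ℝ => 1 + t ^ 2).inv₀ fun t => by positivity

theorem isSelfAdjoint_resolv (a : B) : IsSelfAdjoint (resolv a) := cfc_predicate _ a

theorem resolv_mul {a : B} (ha : IsSelfAdjoint a) : resolv a * (1 + a * a) = 1 := by
  have h : (1 + a * a : B) = cfc (fun t : ℝ => 1 + t ^ 2) a := by
    rw [cfc_const_add (1 : ℝ) (fun t : ℝ => t ^ 2) a, cfc_pow_id (R := ℝ) a 2, map_one, pow_two]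
  rw [h, resolv, ← cfc_mul _ _ a continuous_resolv.continuousOn (by fun_prop),
    cfc_congr (g := fun _ => (1 : ℝ)) fun t _ => inv_mul_cancel₀ (by positivity),
    cfc_const_one ℝ a]

theorem mul_resolv {a : B} (ha : IsSelfAdjoint a) : (1 + a * a) * resolv a = 1 := by
  have := congrArg star (resolv_mul ha)
  simpa [(isSelfAdjoint_resolv a).star_eq, ha.star_eq] using this

theorem cfc_bend_eq {a : B} (ha : IsSelfAdjoint a) : cfc bend a = (2 : ℂ) • (resolv a * a) := by
  have h : resolv a * a = cfc (fun t : ℝ => (1 + t ^ 2)⁻¹ * t) a := by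
    rw [cfc_mul _ _ a continuous_resolv.continuousOn (by fun_prop), cfc_id' ℝ a, resolv]
  rw [h, show (2 : ℂ) = ((2 : ℝ) : ℂ) by norm_num, Complex.coe_smul,
    ← cfc_smul (2 : ℝ) (fun t : ℝ => (1 + t ^ 2)⁻¹ * t) a
      (continuous_resolv.mul continuous_id).continuousOn]
  refine cfc_congr fun t _ => ?_
  simp only [bend, smul_eq_mul]
  ring

theorem cfc_bend_eq' {a : B} (ha : IsSelfAdjoint a) : cfc bend a = (2 : ℂ) • (a * resolv a) := by
  have := congrArg star (cfc_bend_eq ha)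
  have h : IsSelfAdjoint (cfc bend a) := cfc_predicate _ a
  simpa [(isSelfAdjoint_resolv a).star_eq, ha.star_eq, h.star_eq] using this

/-- The identity behind the strong continuity of `a ↦ 2a / (1 + a²)`. -/
theorem cfc_bend_sub {a y : B} (ha : IsSelfAdjoint a) (hy : IsSelfAdjoint y) :
    cfc bend a - cfc bend y = (2 : ℂ) • (resolv a * ((a - y) * resolv y)) -
      (1 / 2 : ℂ) • (cfc bend a * ((a - y) * cfc bend y)) := by
  have h1 : cfc bend a = (2 : ℂ) • (resolv a * a * ((1 + y * y) * resolv y)) := by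
    rw [mul_resolv hy, mul_one, cfc_bend_eq ha]
  have h2 : cfc bend y = (2 : ℂ) • (resolv a * (1 + a * a) * (y * resolv y)) := by
    rw [resolv_mul ha, one_mul, cfc_bend_eq' hy]
  have h3 : (1 / 2 : ℂ) • (cfc bend a * ((a - y) * cfc bend y)) =
      (2 : ℂ) • (resolv a * a * ((a - y) * (y * resolv y))) := by
    rw [cfc_bend_eq ha, cfc_bend_eq' hy, smul_mul_assoc, mul_smul_comm, mul_smul_comm, smul_smul,
      smul_smul]
    norm_num
  rw [h3]
  nth_rw 1 [h1, h2]
  rw [← smul_sub, ← smul_sub]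
  congr 1
  noncomm_ring

theorem exists_cfc_bend_eq {a : B} (ha : IsSelfAdjoint a) (h1 : ‖a‖ ≤ 1) :
    ∃ y : B, IsSelfAdjoint y ∧ cfc bend y = a := by
  have hc : Continuous fun t : ℝ => t / (1 + √(1 - t ^ 2)) :=
    continuous_id.div (by fun_prop) fun t => by positivity
  cases subsingleton_or_nontrivial B
  · exact ⟨0, .zero B, Subsingleton.elim _ _⟩
  refine ⟨cfc (fun t : ℝ => t / (1 + √(1 - t ^ 2))) a, cfc_predicate _ a, ?_⟩
  rw [← cfc_comp' bend _ a continuous_bend.continuousOn hc.continuousOn]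
  conv_rhs => rw [← cfc_id ℝ a]
  refine cfc_congr fun t ht => bend_surj ?_
  exact (spectrum.norm_le_norm_of_mem (a := a) ht).trans h1

end Kaplansky

/-! ### Norms of differences of vector functionals -/

section NormBound

variable {B : Type*} [CStarAlgebra B]
variable {𝓗 : Type*} [NormedAddCommGroup 𝓗] [InnerProductSpace ℂ 𝓗] [CompleteSpace 𝓗]

/-- Strong continuity of `a ↦ 2a / (1 + a²)` in terms of a vector functional. -/
theorem norm_inner_cfc_bend_sub_le (ρ : B →⋆ₐ[ℂ] (𝓗 →L[ℂ] 𝓗)) {a y : B} (ha : IsSelfAdjoint a)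
    (hy : IsSelfAdjoint y) (P : 𝓗) {δ : ℝ} (h₁ : ‖(ρ a - ρ y) (ρ (resolv y) P)‖ ≤ δ)
    (h₂ : ‖(ρ a - ρ y) (ρ (cfc bend y) P)‖ ≤ δ) :
    ‖⟪P, ρ (cfc bend a) P⟫_ℂ - ⟪P, ρ (cfc bend y) P⟫_ℂ‖ ≤ 3 * ‖P‖ * δ := by
  have hδ : 0 ≤ δ := (norm_nonneg _).trans h₁
  have key : ∀ b : B, ‖b‖ ≤ 1 → ∀ v : 𝓗, ‖v‖ ≤ δ → ‖⟪P, ρ b v⟫_ℂ‖ ≤ ‖P‖ * δ := by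
    intro b hb v hv
    refine (norm_inner_le_norm _ _).trans (mul_le_mul_of_nonneg_left ?_ (norm_nonneg _))
    refine ((ρ b).le_opNorm v).trans ?_
    calc ‖ρ b‖ * ‖v‖ ≤ 1 * δ := by
          gcongr
          exact (NonUnitalStarAlgHom.norm_apply_le ρ b).trans hb
      _ = δ := one_mul δ
  have k₁ := key _ (norm_resolv_le a) _ h₁
  have k₂ := key _ (norm_cfc_bend_le a) _ h₂
  rw [← inner_sub_right, ← sub_apply, ← map_sub, cfc_bend_sub ha hy, map_sub, map_smul, map_smul,
    map_mul, map_mul, map_mul, map_mul, map_sub, sub_apply, smul_apply, smul_apply,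
    inner_sub_right, inner_smul_right, inner_smul_right]
  simp only [mul_apply_eq_comp]
  refine (norm_sub_le _ _).trans ?_
  rw [norm_mul, norm_mul]
  have h2 : ‖(2 : ℂ)‖ = 2 := by norm_num
  have h3 : ‖(1 / 2 : ℂ)‖ = 1 / 2 := by norm_num
  rw [h2, h3]
  linarith [mul_nonneg (norm_nonneg P) hδ]

/-- A hermitian functional which is bounded by `ε` on self-adjoint contractions has norm at most
`ε`. -/
theorem norm_le_of_isSelfAdjoint {f : B →L[ℂ] ℂ} (hf : ∀ T, f (star T) = star (f T)) {ε : ℝ}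
    (hε : 0 ≤ ε) (h : ∀ T, IsSelfAdjoint T → ‖T‖ ≤ 1 → ‖f T‖ ≤ ε) : ‖f‖ ≤ ε := by
  have h' : ∀ T, IsSelfAdjoint T → ‖f T‖ ≤ ε * ‖T‖ := by
    intro T hT
    rcases eq_or_ne T 0 with rfl | hT0
    · simp
    have hn : 0 < ‖T‖ := norm_pos_iff.2 hT0
    have h1 := h (((‖T‖⁻¹ : ℝ) : ℂ) • T)
      (by
        rw [IsSelfAdjoint, star_smul, hT.star_eq, Complex.star_def, Complex.conj_ofReal])
      (by rw [norm_smul, Complex.norm_real, norm_inv, norm_norm, inv_mul_cancel₀ hn.ne'])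
    rwa [map_smul, norm_smul, Complex.norm_real, norm_inv, norm_norm, inv_mul_le_iff₀ hn,
      mul_comm] at h1
  refine f.opNorm_le_bound hε fun T => ?_
  rcases eq_or_ne (f T) 0 with h0 | h0
  · rw [h0, norm_zero]; positivity
  -- rotate `T` so that `f T` is a positive number, and pass to its real part
  have hn : (‖f T‖ : ℂ) ≠ 0 := by simpa using h0
  let c : ℂ := star (f T) / ‖f T‖
  have hc : ‖c‖ = 1 := by
    simp [c, h0]
  have hcf : c * f T = ‖f T‖ := by
    have := Complex.conj_mul' (f T)
    rw [div_mul_eq_mul_div, Complex.star_def, this]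
    field_simp
  have hS : f (realPart (c • T) : B) = ‖f T‖ := by
    rw [realPart_apply_coe, ← Complex.coe_smul, map_smul, map_add, hf, map_smul, smul_eq_mul,
      smul_eq_mul, hcf, Complex.star_def, Complex.conj_ofReal]
    push_cast
    ring
  have h2 := h' _ (realPart (c • T)).2
  rw [hS, Complex.norm_real, norm_norm] at h2
  refine h2.trans (mul_le_mul_of_nonneg_left ?_ hε)
  have h3 := realPart.norm_le (c • T)
  rwa [norm_smul, hc, one_mul] at h3

/-- The norm of a difference of two vector functionals is determined on C⋆-subalgebras whose
self-adjoint parts are jointly strongly dense. -/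
theorem norm_le_of_approx {J : Type*} {C : J → Type*} [∀ i, CStarAlgebra (C i)]
    (Φ : ∀ i, C i →⋆ₐ[ℂ] B) (ρ : B →⋆ₐ[ℂ] (𝓗 →L[ℂ] 𝓗))
    (happ : ∀ y : B, IsSelfAdjoint y → ∀ Q : L2 𝓗, ∀ δ : ℝ, 0 < δ →
      ∃ i, ∃ a : C i, IsSelfAdjoint a ∧ ‖amp (ρ (Φ i a) - ρ y) Q‖ ≤ δ)
    {f : B →L[ℂ] ℂ} {P Q : 𝓗} (hf : ∀ T, f T = ⟪P, ρ T P⟫_ℂ - ⟪Q, ρ T Q⟫_ℂ) {ε : ℝ} (hε : 0 ≤ ε)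
    (h : ∀ i a, ‖f (Φ i a)‖ ≤ ε * ‖a‖) : ‖f‖ ≤ ε := by
  refine norm_le_of_isSelfAdjoint (fun T => ?_) hε fun T hT hT1 => ?_
  · have h1 : ∀ v : 𝓗, ⟪v, ρ (star T) v⟫_ℂ = star ⟪v, ρ T v⟫_ℂ := fun v => by
      rw [map_star, Complex.star_def, inner_conj_symm, ← inner_star_apply, star_star]
    rw [hf, hf, h1, h1, star_sub]
  obtain ⟨y, hy, rfl⟩ := exists_cfc_bend_eq hT hT1
  refine le_of_forall_pos_le_add fun δ hδ => ?_
  -- approximate `y` on the four vectors which occur in the estimates for `P` and `Q`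
  have hC : 0 < 3 * ‖P‖ + 3 * ‖Q‖ + 1 := by positivity
  obtain ⟨i, a, ha, hai⟩ := happ y hy (slot 0 (ρ (resolv y) P) + slot 1 (ρ (cfc bend y) P) +
    slot 2 (ρ (resolv y) Q) + slot 3 (ρ (cfc bend y) Q)) _ (div_pos hδ hC)
  have hk := fun k => (lp.norm_apply_le_norm two_ne_zero (amp (ρ (Φ i a) - ρ y) _) k).trans hai
  have hP := norm_inner_cfc_bend_sub_le ρ (ha.map (Φ i)) hy P (by simpa using hk 0)
    (by simpa using hk 1)
  have hQ := norm_inner_cfc_bend_sub_le ρ (ha.map (Φ i)) hy Q (by simpa using hk 2)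
    (by simpa using hk 3)
  have h1 : ‖f (cfc bend (Φ i a))‖ ≤ ε := by
    rw [← StarAlgHom.map_cfc (S := ℂ) (Φ i) bend a continuous_bend.continuousOn
      (AddMonoidHomClass.continuous_of_bound (Φ i) 1 fun b => by
        rw [one_mul]; exact NonUnitalStarAlgHom.norm_apply_le (Φ i) b) ha (ha.map (Φ i))]
    refine (h i _).trans ?_
    calc ε * ‖cfc bend a‖ ≤ ε * 1 := by gcongr; exact norm_cfc_bend_le a
      _ = ε := mul_one ε
  have h2 : ‖f (cfc bend (Φ i a)) - f (cfc bend y)‖ ≤ δ := by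
    rw [hf, hf, sub_sub_sub_comm]
    refine (norm_sub_le _ _).trans ((add_le_add hP hQ).trans ?_)
    rw [← add_mul, mul_div_assoc', div_le_iff₀ hC]
    nlinarith [norm_nonneg P, norm_nonneg Q]
  calc ‖f (cfc bend y)‖ = ‖f (cfc bend (Φ i a)) - (f (cfc bend (Φ i a)) - f (cfc bend y))‖ := by
        rw [sub_sub_cancel]
    _ ≤ ε + δ := (norm_sub_le _ _).trans (add_le_add h1 h2)

end NormBound

/-! ### Matrices over a represented *-algebra -/

section MatRep

variable {ι : Type*} [Fintype ι]
variable {K : Type*} [NormedAddCommGroup K] [InnerProductSpace ℂ K]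

/-- The Hilbert space `K ⊗ ℂ^ι`. -/
abbrev Fam (ι K : Type*) [Fintype ι] [NormedAddCommGroup K] [InnerProductSpace ℂ K] : Type _ :=
  PiLp 2 fun _ : ι => K

/-- A matrix of operators as an operator. -/
def matOp (T : ι → ι → K →L[ℂ] K) : Fam ι K →L[ℂ] Fam ι K :=
  (PiLp.continuousLinearEquiv 2 ℂ fun _ : ι => K).symm.toContinuousLinearMap ∘L
    ContinuousLinearMap.pi fun k => ∑ l, T k l ∘L PiLp.proj 2 (fun _ : ι => K) l

theorem matOp_apply (T : ι → ι → K →L[ℂ] K) (v : Fam ι K) (k : ι) :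
    matOp T v k = ∑ l, T k l (v l) := by
  simp [matOp]

variable [DecidableEq ι] [CompleteSpace K]

/-- Entrywise application of a *-morphism to matrices. -/
def matMap {A B : Type*} [Ring A] [StarRing A] [Algebra ℂ A] [Ring B] [StarRing B] [Algebra ℂ B]
    (g : A →⋆ₐ[ℂ] B) : CStarMatrix ι ι A →⋆ₐ[ℂ] CStarMatrix ι ι B where
  toFun T := T.map g
  map_one' := by
    ext i j
    by_cases h : i = j
    · subst h; simp only [CStarMatrix.map_apply, CStarMatrix.one_apply_eq, map_one]
    · simp only [CStarMatrix.map_apply, CStarMatrix.one_apply_ne h, map_zero]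
  map_mul' S T := by
    ext i j
    simp only [CStarMatrix.mul_apply, CStarMatrix.map_apply, map_sum, map_mul]
  map_zero' := by
    ext i j
    exact map_zero g
  map_add' S T := by
    ext i j
    simp
  commutes' c := by
    ext i j
    simp only [CStarMatrix.map_apply, CStarMatrix.algebraMap_apply]
    split
    · exact AlgHomClass.commutes g c
    · exact map_zero g
  map_star' T := by
    ext i j
    simp [CStarMatrix.star_apply, map_star]

theorem matMap_apply {A B : Type*} [Ring A] [StarRing A] [Algebra ℂ A] [Ring B] [StarRing B]
    [Algebra ℂ B] (g : A →⋆ₐ[ℂ] B) (T : CStarMatrix ι ι A) : matMap g T = T.map g := rfl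

variable {𝒜 : Type*} [Ring 𝒜] [StarRing 𝒜] [Algebra ℂ 𝒜]
/-- The action of matrices over a represented *-algebra on `K ⊗ ℂ^ι`. -/
def matRep (π : 𝒜 →⋆ₐ[ℂ] (K →L[ℂ] K)) :
    CStarMatrix ι ι 𝒜 →⋆ₐ[ℂ] (Fam ι K →L[ℂ] Fam ι K) where
  toFun T := matOp fun k l => π (T k l)
  map_one' := by
    ext v k
    rw [matOp_apply, Finset.sum_eq_single k (fun l _ h => by
      rw [CStarMatrix.one_apply_ne' h, map_zero]; rfl) (by simp), CStarMatrix.one_apply_eq, map_one]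
    rfl
  map_mul' S T := by
    ext v k
    simp only [matOp_apply, CStarMatrix.mul_apply, map_sum, map_mul, mul_apply_eq_comp, sum_apply]
    exact Finset.sum_comm
  map_zero' := by
    ext v k
    simp [matOp_apply, CStarMatrix.zero_apply]
  map_add' S T := by
    ext v k
    simp [matOp_apply, Finset.sum_add_distrib]
  commutes' c := by
    ext v k
    rw [matOp_apply, Finset.sum_eq_single k (fun l _ h => by
      rw [CStarMatrix.algebraMap_apply, if_neg h.symm, map_zero]; rfl) (by simp),
      CStarMatrix.algebraMap_apply, if_pos rfl, AlgHomClass.commutes]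
    rfl
  map_star' T := by
    rw [ContinuousLinearMap.star_eq_adjoint, ContinuousLinearMap.eq_adjoint_iff]
    intro x y
    simp [PiLp.inner_apply, matOp_apply, CStarMatrix.star_apply, map_star, sum_inner, inner_sum,
      ContinuousLinearMap.star_eq_adjoint, ContinuousLinearMap.adjoint_inner_left]
    rw [Finset.sum_comm]

theorem matRep_apply (π : 𝒜 →⋆ₐ[ℂ] (K →L[ℂ] K)) (T : CStarMatrix ι ι 𝒜) (v : Fam ι K) (k : ι) :
    matRep π T v k = ∑ l, π (T k l) (v l) := matOp_apply _ _ _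

/-- The vector `Ω ⊗ φ`. -/
def tensorVec (Ω : K) (φ : EuclideanSpace ℂ ι) : Fam ι K := WithLp.toLp 2 fun k => φ k • Ω

/-- The double commutant of the matrices over `π(𝒜)` contains the matrices over `π(𝒜)''`. -/
theorem matOp_mem_vnGen {π : 𝒜 →⋆ₐ[ℂ] (K →L[ℂ] K)} {T : ι → ι → K →L[ℂ] K}
    (hT : ∀ k l, T k l ∈ vnGen (Set.range π)) :
    matOp T ∈ vnGen (Set.range (matRep (ι := ι) π)) := by
  refine mem_vnGen_iff.2 fun S hS _ => ?_
  let e : ι → K →L[ℂ] Fam ι K := fun i =>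
    (PiLp.continuousLinearEquiv 2 ℂ fun _ : ι => K).symm.toContinuousLinearMap ∘L
      ContinuousLinearMap.single ℂ (fun _ : ι => K) i
  have he : ∀ i x, e i x i = x := fun i x => by simp [e]
  have hcomm : ∀ i l z v, S (e i (π z (v l))) = e i (π z (S v l)) := by
    intro i l z v
    have h1 : ∀ w, matRep π (CStarMatrix.ofMatrix (Matrix.single i l z)) w = e i (π z (w l)) := by
      intro w
      ext k
      rw [matRep_apply]
      by_cases hk : i = k
      · subst hk
        rw [he, Finset.sum_eq_single l (fun j _ hj => by simp [hj.symm])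
          (by simp)]
        simp
      · simp [e, hk, Ne.symm hk]
    have h2 := congrArg (fun R : Fam ι K →L[ℂ] Fam ι K => R v) (hS _ ⟨CStarMatrix.ofMatrix (Matrix.single i l z), rfl⟩)
    simpa only [mul_apply_eq_comp, h1] using h2.symm
  ext v i
  -- `S` acts diagonally through one operator `t` of the commutant of `π(𝒜)`
  let t : K →L[ℂ] K := PiLp.proj 2 (fun _ : ι => K) i ∘L S ∘L e i
  have ht : ∀ x, t x = S (e i x) i := fun x => rfl
  have ht1 : ∀ (v : Fam ι K) l, t (v l) = S v l := fun v l => by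
    have := hcomm i l 1 v
    rw [map_one, one_apply_eq_self, one_apply_eq_self] at this
    rw [ht, this, he]
  have ht2 : ∀ z, π z * t = t * π z := fun z => by
    ext x
    have := hcomm i i z (e i x)
    rw [he] at this
    rw [mul_apply_eq_comp, mul_apply_eq_comp, ht, ht, this, he]
  have ht3 : ∀ l, t * T i l = T i l * t := fun l =>
    mem_vnGen_iff.1 (hT i l) t (Set.forall_mem_range.2 ht2)
      (Set.forall_mem_range.2 fun z => by rw [← map_star]; exact ht2 _)
  rw [mul_apply_eq_comp, mul_apply_eq_comp, ← ht1, matOp_apply, matOp_apply, map_sum]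
  refine Finset.sum_congr rfl fun l _ => ?_
  rw [← mul_apply_eq_comp, ht3, mul_apply_eq_comp, ht1]

/-- `ω ⊗ φ` is a vector functional if `ω` is one. -/
theorem tensorPure_eq_inner {A : Type*} [CStarAlgebra A] [PartialOrder A] [StarOrderedRing A]
    {σ : A →L[ℂ] ℂ} {π : A →⋆ₐ[ℂ] (K →L[ℂ] K)} {Ω : K} (hσ : ∀ a, σ a = ⟪Ω, π a Ω⟫_ℂ)
    (φ : EuclideanSpace ℂ ι) (T : CStarMatrix ι ι A) :
    tensorPure σ φ T = ⟪tensorVec Ω φ, matRep π T (tensorVec Ω φ)⟫_ℂ := by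
  simp only [tensorPure, tensorVec, PiLp.inner_apply, matRep_apply, inner_sum, map_smul,
    inner_smul_left, inner_smul_right, sum_apply, smul_apply, ContinuousLinearMap.comp_apply, hσ]
  refine Finset.sum_congr rfl fun i _ => Finset.sum_congr rfl fun j _ => ?_
  rw [smul_eq_mul, mul_assoc, mul_left_comm]
  rfl

/-- The error in embezzlement is the norm of a difference of two vector functionals. -/
theorem conjBy_tensorPure_sub_eq_inner {A : Type*} [CStarAlgebra A] [PartialOrder A]
    [StarOrderedRing A] {σ : A →L[ℂ] ℂ} {π : A →⋆ₐ[ℂ] (K →L[ℂ] K)} {Ω : K}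
    (hσ : ∀ a, σ a = ⟪Ω, π a Ω⟫_ℂ) (φ ψ : EuclideanSpace ℂ ι) (u T : CStarMatrix ι ι A) :
    (conjBy u (tensorPure σ φ) - tensorPure σ ψ) T =
      ⟪matRep π u (tensorVec Ω φ), matRep π T (matRep π u (tensorVec Ω φ))⟫_ℂ -
        ⟪tensorVec Ω ψ, matRep π T (tensorVec Ω ψ)⟫_ℂ := by
  have h : conjBy u (tensorPure σ φ) T = tensorPure σ φ (star u * T * u) := rfl
  rw [sub_apply, h, tensorPure_eq_inner hσ, tensorPure_eq_inner hσ, map_mul, map_mul, map_star,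
    mul_apply_eq_comp, mul_apply_eq_comp, ← inner_star_apply, star_star]

theorem conjBy_tensorPure_matMap {A B : Type*} [CStarAlgebra A] [PartialOrder A]
    [StarOrderedRing A] [CStarAlgebra B] [PartialOrder B] [StarOrderedRing B] {σ : A →L[ℂ] ℂ}
    {τ : B →L[ℂ] ℂ} {g : A →⋆ₐ[ℂ] B} (hg : ∀ a, τ (g a) = σ a) (φ ψ : EuclideanSpace ℂ ι)
    (u T : CStarMatrix ι ι A) :
    (conjBy (matMap g u) (tensorPure τ φ) - tensorPure τ ψ) (matMap g T) =
      (conjBy u (tensorPure σ φ) - tensorPure σ ψ) T := by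
  have h : ∀ χ (S : CStarMatrix ι ι A), tensorPure τ χ (matMap g S) = tensorPure σ χ S := by
    intro χ S
    simp only [tensorPure, sum_apply, smul_apply, ContinuousLinearMap.comp_apply, ← hg]
    rfl
  have h1 : conjBy u (tensorPure σ φ) T = tensorPure σ φ (star u * T * u) := rfl
  have h2 : conjBy (matMap g u) (tensorPure τ φ) (matMap g T) =
      tensorPure τ φ (star (matMap g u) * matMap g T * matMap g u) := rfl
  rw [sub_apply, sub_apply, h1, h2, ← map_star, ← map_mul, ← map_mul, h, h]

end MatRep

/-! ### Transport of local unitaries -/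

section LocalTransport

variable {N : ℕ} {H K : Type*} [NormedAddCommGroup H] [InnerProductSpace ℂ H] [CompleteSpace H]
  [NormedAddCommGroup K] [InnerProductSpace ℂ K] [CompleteSpace K]

/-- A *-morphism of the `N`-partite algebras which maps the algebras of the parties into each
other maps products of local unitaries to products of local unitaries. -/
theorem exists_prodUnitary_eq_map {S : PartiteSystem N H} {S' : PartiteSystem N K}
    (g : Alg S.total →⋆ₐ[ℂ] Alg S'.total)
    (hg : ∀ (x : Fin N) (a : Alg S.total), (a : H →L[ℂ] H) ∈ S.loc x →
      (g a : K →L[ℂ] K) ∈ S'.loc x) {d : ℕ} (U : S.LocalUnitaries d) :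
    ∃ U' : S'.LocalUnitaries d, S'.prodUnitary U' = (S.prodUnitary U).map g := by
  let r : ∀ x, Alg (S.loc x) →⋆ₐ[ℂ] Alg (S'.loc x) := fun x =>
    ((S'.total.toStarSubalgebra.subtype.comp g).comp (S.incl x)).codRestrict
      (S'.loc x).toStarSubalgebra fun a => hg x _ a.2
  have hr : ∀ x a, S'.incl x (r x a) = g (S.incl x a) := fun x a => rfl
  refine ⟨fun x => ⟨matMap (r x) (U x), ?_⟩, ?_⟩
  · rw [Unitary.mem_iff, ← map_star, ← map_mul, ← map_mul, Unitary.star_mul_self_of_mem (U x).2,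
      Unitary.mul_star_self_of_mem (U x).2, map_one]
    exact ⟨rfl, rfl⟩
  · rw [← matMap_apply, PartiteSystem.prodUnitary, PartiteSystem.prodUnitary, map_list_prod,
      List.map_ofFn]
    congr 2
    funext x
    ext1 i j
    change (if ∀ y, y ≠ x → i y = j y then S'.incl x (r x ((U x : CStarMatrix _ _ _) (i x) (j x)))
      else 0) = g (if ∀ y, y ≠ x → i y = j y then S.incl x ((U x : CStarMatrix _ _ _) (i x) (j x))
        else 0)
    split
    · rw [hr]
    · rw [map_zero]

end LocalTransport

/-! ### The limit state is embezzling -/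

section LimitEmbezzling

variable {N : ℕ} {I : Type u} [Preorder I] [IsDirectedOrder I] [Nonempty I] {H : I → Type v}
  [∀ n, NormedAddCommGroup (H n)] [∀ n, InnerProductSpace ℂ (H n)] [∀ n, CompleteSpace (H n)]
  {D : IncreasingNet N I H}
variable {K : Type*} [NormedAddCommGroup K] [InnerProductSpace ℂ K] [CompleteSpace K]
variable {ω : (n : I) → NormalState (D.sys n).total} {π : LimAlg D →⋆ₐ[ℂ] (K →L[ℂ] K)} {Ω : K}

theorem mem_vnGen_of_mem_total {b : K →L[ℂ] K} (hb : b ∈ (limSystem π).total) :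
    b ∈ vnGen (Set.range π) := by
  refine vnGen_le (fun T hT => ?_) hb
  obtain ⟨i, hi⟩ := Set.mem_iUnion.1 hT
  exact vnGen_le (fun R hR => mem_vnGen (Set.image_subset_range _ _ hR)) hi

/-- Matrices over the direct limit come from late stages. -/
theorem exists_matMap_toLim {ι : Type*} [Fintype ι] [DecidableEq ι] (n : I)
    (z : CStarMatrix ι ι (LimAlg D)) :
    ∃ m, n ≤ m ∧ ∃ a : CStarMatrix ι ι (Alg (D.sys m).total), z = matMap (toLim D m) a := by
  choose k a hk using fun p : ι × ι => exists_toLim (z p.1 p.2)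
  obtain ⟨m₀, hm₀⟩ := Finite.exists_le k
  obtain ⟨m, hm, hn⟩ := exists_ge_ge m₀ n
  refine ⟨m, hn, CStarMatrix.ofMatrix fun i j => D.inc ((hm₀ (i, j)).trans hm) (a (i, j)), ?_⟩
  ext i j
  exact (hk (i, j)).trans (toLim_inc _ _).symm

/-- Self-adjoint matrices over the limit algebra are strong limits of self-adjoint matrices over
the algebras of late stages. -/
theorem exists_isSelfAdjoint_approx (hπ : IsLimGNS ω π Ω) {ι : Type*} [Fintype ι] [DecidableEq ι]
    (n : I) {y : CStarMatrix ι ι (Alg (limSystem π).total)} (hy : IsSelfAdjoint y)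
    (Q : L2 (Fam ι K)) {δ : ℝ} (hδ : 0 < δ) :
    ∃ m, n ≤ m ∧ ∃ a : CStarMatrix ι ι (Alg (D.sys m).total), IsSelfAdjoint a ∧
      ‖amp (matRep (limSystem π).total.toStarSubalgebra.subtype (matMap (limHom hπ m) a) -
        matRep (limSystem π).total.toStarSubalgebra.subtype y) Q‖ ≤ δ := by
  have hmem : matRep (limSystem π).total.toStarSubalgebra.subtype y ∈
      vnGen (Set.range (matRep (ι := ι) π)) :=
    matOp_mem_vnGen fun k l => mem_vnGen_of_mem_total (y k l).2
  obtain ⟨z, hz₁, hz₂⟩ := exists_strongStar_approx hmem Q hδ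
  obtain ⟨m, hm, b, rfl⟩ := exists_matMap_toLim n z
  have hb : matRep π (matMap (toLim D m) b) =
      matRep (limSystem π).total.toStarSubalgebra.subtype (matMap (limHom hπ m) b) := rfl
  refine ⟨m, hm, (2⁻¹ : ℂ) • (b + star b), ?_, ?_⟩
  · rw [IsSelfAdjoint, star_smul, star_add, star_star, add_comm]
    simp
  rw [hb] at hz₁ hz₂
  rw [← map_star, ← map_star, ← map_star, hy.star_eq] at hz₂
  set R := matRep (ι := ι) (limSystem π).total.toStarSubalgebra.subtype
  set Φ := matMap (ι := ι) (limHom hπ m)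
  have h : R (Φ ((2⁻¹ : ℂ) • (b + star b))) - R y =
      (2⁻¹ : ℂ) • ((R (Φ b) - R y) + (R (Φ (star b)) - R y)) := by
    rw [map_smul, map_smul, map_add, map_add]
    module
  rw [h, amp_smul, amp_add, smul_apply, add_apply, norm_smul]
  have h2 : ‖(2⁻¹ : ℂ)‖ = 2⁻¹ := by norm_num
  rw [h2]
  linarith [norm_add_le (amp (R (Φ b) - R y) Q) (amp (R (Φ (star b)) - R y) Q)]

/-- Local unitaries from quasi-consistency at one stage also work in the limit. -/
theorem IsLimGNS.isEmbezzling (hπ : IsLimGNS ω π Ω) (hω : IsQuasiConsistent D ω) :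
    (limSystem π).IsEmbezzling (limNormalState hπ) := by
  intro d φ ψ hφ hψ ε hε
  -- the bound at the stages passes to the limit with `≤` only, hence `ε / 2`
  obtain ⟨n, hn⟩ := hω d (ε / 2) (half_pos hε)
  obtain ⟨U, hU⟩ := hn φ ψ hφ hψ
  obtain ⟨U', hU'⟩ := exists_prodUnitary_eq_map (S' := limSystem π) (limHom hπ n)
    (fun x a ha => mem_vnGen (Set.mem_image_of_mem _ (toLim_mem_locSet ha))) U
  refine ⟨U', lt_of_le_of_lt ?_ (half_lt_self hε)⟩
  rw [embezzlingError]
  refine norm_le_of_approx (J := {m // n ≤ m})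
    (C := fun m => CStarMatrix (Fin N → Fin d) (Fin N → Fin d) (Alg (D.sys m).total))
    (fun m => matMap (limHom hπ m)) (matRep (limSystem π).total.toStarSubalgebra.subtype)
    (fun y hy Q δ hδ => ?_)
    (conjBy_tensorPure_sub_eq_inner (limNormalState_apply hπ) φ ψ _)
    (half_pos hε).le fun m a => ?_
  · obtain ⟨m, hm, a, ha⟩ := exists_isSelfAdjoint_approx hπ n hy Q hδ
    exact ⟨⟨m, hm⟩, a, ha⟩
  · have h1 : (limSystem π).prodUnitary U' =
        matMap (limHom hπ m) (((D.sys n).prodUnitary U).map (D.inc m.2)) := by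
      rw [hU']
      ext1 i j
      exact Subtype.ext (congrArg π (toLim_inc m.2 _).symm)
    rw [h1, conjBy_tensorPure_matMap (σ := (ω m).toCLM) fun a => hπ.state m a]
    exact (ContinuousLinearMap.le_opNorm _ _).trans
      (mul_le_mul_of_nonneg_right (hU m m.2).le (norm_nonneg _))

theorem IsLimGNS.isEmbezzlingLimit (hπ : IsLimGNS ω π Ω) (hω : IsQuasiConsistent D ω) :
    IsEmbezzlingLimit D ω (limSystem π) (limHom hπ) (limNormalState hπ) where
  embezzling := hπ.isEmbezzling hω
  normal := limHom_isNormal hπ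
  compat h a := Subtype.ext (congrArg π (toLim_inc h a))
  map_loc _ _ _ ha := mem_vnGen (Set.mem_image_of_mem _ (toLim_mem_locSet ha))
  total_eq := limSystem_total_eq hπ
  centralSupport := limNormalState_centralSupport hπ
  state_comp n a := hπ.state n a

end LimitEmbezzling

/-! ### Uniqueness -/

section Uniqueness

variable {N : ℕ} {I : Type u} [Preorder I] [IsDirectedOrder I] [Nonempty I] {H : I → Type v}
  [∀ n, NormedAddCommGroup (H n)] [∀ n, InnerProductSpace ℂ (H n)] [∀ n, CompleteSpace (H n)]
  {D : IncreasingNet N I H} {ω : (n : I) → NormalState (D.sys n).total}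
variable {L : Type*} [NormedAddCommGroup L] [InnerProductSpace ℂ L] [CompleteSpace L]
  {π : LimAlg D →⋆ₐ[ℂ] (L →L[ℂ] L)} {Ω : L}
variable {K : Type*} [NormedAddCommGroup K] [InnerProductSpace ℂ K] [CompleteSpace K]
  {S : PartiteSystem N K} {j : (n : I) → Alg (D.sys n).total →⋆ₐ[ℂ] Alg S.total}
  {σ : NormalState S.total}

/-- Every limit of the family is isomorphic to the von Neumann algebra of the GNS representation of
the direct limit. -/
theorem IsEmbezzlingLimit.exists_equiv (hS : IsEmbezzlingLimit D ω S j σ) (hπ : IsLimGNS ω π Ω) :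
    ∃ Φ : Alg S.total ≃⋆ₐ[ℂ] Alg (vnGen (Set.range π)),
      (∀ n a, (Φ (j n a) : L →L[ℂ] L) = π (toLim D n a)) ∧
      (∀ b, ⟪Ω, (Φ b : L →L[ℂ] L) Ω⟫_ℂ = σ.toCLM b) ∧
      (IsGeneratedBy D S j → ∀ x (b : Alg S.total),
        (b : K →L[ℂ] K) ∈ S.loc x ↔ (Φ b : L →L[ℂ] L) ∈ vnGen (π '' locSet D x)) := by
  let ρ : LimAlg D →⋆ₐ[ℂ] (K →L[ℂ] K) :=
    StarLimit.lift (fun n => S.total.toStarSubalgebra.subtype.comp (j n))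
      fun m n h a => congrArg Subtype.val (hS.compat h a)
  have hρ : ∀ n a, ρ (toLim D n a) = j n a := fun n a => StarLimit.lift_of _ _ _ _
  have hM : S.total = vnGen (Set.range ρ) := by
    rw [hS.total_eq]
    congr 1
    ext T
    simp only [Set.mem_iUnion, Set.mem_range]
    constructor
    · rintro ⟨n, a, rfl⟩
      exact ⟨_, hρ n a⟩
    · rintro ⟨x, rfl⟩
      obtain ⟨n, a, rfl⟩ := exists_toLim x
      exact ⟨n, a, (hρ n a).symm⟩
  have hmem : ∀ x, ρ x ∈ S.total := fun x => hM ▸ mem_vnGen (Set.mem_range_self x)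
  obtain ⟨Φ, hΦ₁, hΦ₂, hΦ₃⟩ := exists_quasiEquiv hπ.dense hM σ (fun x h => by
    obtain ⟨n, a, rfl⟩ := exists_toLim x
    rw [hπ.state, ← hS.state_comp]
    exact congrArg σ.toCLM (Subtype.ext (hρ n a))) hS.centralSupport
  refine ⟨Φ, fun n a => ?_, hΦ₂, fun hg x b => ?_⟩
  · rw [← hΦ₁ _ (hmem _)]
    exact congrArg (fun b => (Φ b : L →L[ℂ] L)) (Subtype.ext (hρ n a).symm)
  · rw [← hΦ₃ _ (star_mem_locSet x), hg x]
    have : (⋃ n, (fun a : Alg (D.sys n).total => (j n a : K →L[ℂ] K)) ''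
        {a | (a : H n →L[ℂ] H n) ∈ (D.sys n).loc x}) = ρ '' locSet D x := by
      simp only [locSet, Set.image_iUnion, Set.image_image, hρ]
    rw [this]

/-- Any two limits are isomorphic, through the GNS representation of the direct limit. -/
theorem IsEmbezzlingLimit.exists_starAlgEquiv {K' : Type*} [NormedAddCommGroup K']
    [InnerProductSpace ℂ K'] [CompleteSpace K'] {S' : PartiteSystem N K'}
    {j' : (n : I) → Alg (D.sys n).total →⋆ₐ[ℂ] Alg S'.total} {σ' : NormalState S'.total}
    (hS : IsEmbezzlingLimit D ω S j σ) (hS' : IsEmbezzlingLimit D ω S' j' σ')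
    (hπ : IsLimGNS ω π Ω) : ∃ Θ : Alg S.total ≃⋆ₐ[ℂ] Alg S'.total,
      (∀ n a, Θ (j n a) = j' n a) ∧ (∀ b, σ'.toCLM (Θ b) = σ.toCLM b) ∧
      (IsGeneratedBy D S j → IsGeneratedBy D S' j' → ∀ x (b : Alg S.total),
        (b : K →L[ℂ] K) ∈ S.loc x ↔ (Θ b : K' →L[ℂ] K') ∈ S'.loc x) := by
  obtain ⟨Φ, h₁, h₂, h₃⟩ := hS.exists_equiv hπ
  obtain ⟨Φ', h₁', h₂', h₃'⟩ := hS'.exists_equiv hπ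
  have hΘ : ∀ b, Φ' (Φ.trans Φ'.symm b) = Φ b := fun b => Φ'.apply_symm_apply (Φ b)
  refine ⟨Φ.trans Φ'.symm, fun n a => ?_, fun b => ?_, fun hg hg' x b => ?_⟩
  · refine Φ'.injective (Subtype.ext ?_)
    change (Φ' (Φ.trans Φ'.symm (j n a)) : L →L[ℂ] L) = Φ' (j' n a)
    rw [hΘ, h₁, h₁']
  · rw [← h₂', hΘ, h₂]
  · rw [h₃ hg, h₃' hg', hΘ]

end Uniqueness

end

end MultipartiteEmbezzlement

theorem mainTheorem3 {N : ℕ} {I : Type u} [Preorder I] [IsDirectedOrder I] {H : I → Type v}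
    [∀ n, NormedAddCommGroup (H n)] [∀ n, InnerProductSpace ℂ (H n)] [∀ n, CompleteSpace (H n)]
    (D : IncreasingNet N I H)
    (ω : (n : I) → NormalState (D.sys n).total)
    (hω : IsConsistentEmbezzlingFamily D ω) :
    -- existence
    (∃ (K : Type (max u v)) (_ : NormedAddCommGroup K) (_ : InnerProductSpace ℂ K)
        (_ : CompleteSpace K) (S : PartiteSystem N K)
        (j : (n : I) → Alg (D.sys n).total →⋆ₐ[ℂ]
          Alg S.total)
        (σ : NormalState S.total),
      IsEmbezzlingLimit D ω S j σ ∧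
      ((Filter.atTop : Filter I).IsCountablyGenerated →
        (∀ n, TopologicalSpace.SeparableSpace (H n)) → TopologicalSpace.SeparableSpace K)) ∧
    -- uniqueness of the triple
    (∀ (K₁ : Type w₁) [NormedAddCommGroup K₁] [InnerProductSpace ℂ K₁] [CompleteSpace K₁]
        (K₂ : Type w₂) [NormedAddCommGroup K₂] [InnerProductSpace ℂ K₂] [CompleteSpace K₂]
        (S₁ : PartiteSystem N K₁)
        (j₁ : (n : I) → Alg (D.sys n).total →⋆ₐ[ℂ]
          Alg S₁.total)
        (σ₁ : NormalState S₁.total)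
        (S₂ : PartiteSystem N K₂)
        (j₂ : (n : I) → Alg (D.sys n).total →⋆ₐ[ℂ]
          Alg S₂.total)
        (σ₂ : NormalState S₂.total),
      IsEmbezzlingLimit D ω S₁ j₁ σ₁ →
      IsEmbezzlingLimit D ω S₂ j₂ σ₂ →
      ∃ Θ : Alg S₁.total ≃⋆ₐ[ℂ] Alg S₂.total,
        (∀ n a, Θ (j₁ n a) = j₂ n a) ∧ ∀ b, σ₂.toCLM (Θ b) = σ₁.toCLM b) ∧
    -- the factorial case
    ((∀ n, (D.sys n).IsFactorial) →
      (∃ (K : Type (max u v)) (_ : NormedAddCommGroup K) (_ : InnerProductSpace ℂ K)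
          (_ : CompleteSpace K) (S : PartiteSystem N K)
          (j : (n : I) → Alg (D.sys n).total →⋆ₐ[ℂ]
            Alg S.total)
          (σ : NormalState S.total),
        IsEmbezzlingLimit D ω S j σ ∧
        IsGeneratedBy D S j ∧
        (∀ n, Function.Injective (j n)) ∧
        ((Filter.atTop : Filter I).IsCountablyGenerated →
          (∀ n, TopologicalSpace.SeparableSpace (H n)) → TopologicalSpace.SeparableSpace K)) ∧
      (∀ (K₁ : Type w₁) [NormedAddCommGroup K₁] [InnerProductSpace ℂ K₁] [CompleteSpace K₁]
          (K₂ : Type w₂) [NormedAddCommGroup K₂] [InnerProductSpace ℂ K₂] [CompleteSpace K₂]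
          (S₁ : PartiteSystem N K₁)
          (j₁ : (n : I) → Alg (D.sys n).total →⋆ₐ[ℂ]
            Alg S₁.total)
          (σ₁ : NormalState S₁.total)
          (S₂ : PartiteSystem N K₂)
          (j₂ : (n : I) → Alg (D.sys n).total →⋆ₐ[ℂ]
            Alg S₂.total)
          (σ₂ : NormalState S₂.total),
        IsEmbezzlingLimit D ω S₁ j₁ σ₁ →
        IsGeneratedBy D S₁ j₁ →
        IsEmbezzlingLimit D ω S₂ j₂ σ₂ →
        IsGeneratedBy D S₂ j₂ →
        ∃ Θ : Alg S₁.total ≃⋆ₐ[ℂ]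
            Alg S₂.total,
          (∀ n a, Θ (j₁ n a) = j₂ n a) ∧ (∀ b, σ₂.toCLM (Θ b) = σ₁.toCLM b) ∧
          ∀ (x : Fin N) (b : Alg S₁.total),
            (b : K₁ →L[ℂ] K₁) ∈ S₁.loc x ↔ (Θ b : K₂ →L[ℂ] K₂) ∈ S₂.loc x)) := by
  obtain ⟨n₀, -⟩ := hω.quasiConsistent 0 1 one_pos
  have : Nonempty I := ⟨n₀⟩
  obtain ⟨K, _, _, _, π, Ω, hπ⟩ := exists_isLimGNS ω hω.restrict
  refine ⟨⟨K, _, _, _, _, _, _, hπ.isEmbezzlingLimit hω.quasiConsistent, hπ.separableSpace⟩,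
    ?_, fun hf => ⟨⟨K, _, _, _, _, _, _, hπ.isEmbezzlingLimit hω.quasiConsistent,
      limSystem_isGeneratedBy hπ, fun n => limHom_injective hπ n (hf n).2, hπ.separableSpace⟩, ?_⟩⟩
  · intro K₁ _ _ _ K₂ _ _ _ S₁ j₁ σ₁ S₂ j₂ σ₂ h₁ h₂
    obtain ⟨Θ, hΘ, hΘσ, -⟩ := h₁.exists_starAlgEquiv h₂ hπ
    exact ⟨Θ, hΘ, hΘσ⟩
  · intro K₁ _ _ _ K₂ _ _ _ S₁ j₁ σ₁ S₂ j₂ σ₂ h₁ hg₁ h₂ hg₂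
    obtain ⟨Θ, hΘ, hΘσ, hΘl⟩ := h₁.exists_starAlgEquiv h₂ hπ
    exact ⟨Θ, hΘ, hΘσ, hΘl hg₁ hg₂⟩
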